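/- **Setting.** Latin indices run over $1,2,3$, Greek indices over $1,2$; repeated indices are summed. Let $U\subset\mathbb R^2$ be open and let $\Phi:U\to S^2\subset\mathbb R^3$ be an arbitrary coordinate parametrization of an open part of the unit sphere ($C^2$, injective, with injective differential), with surface coordinates $\xi=(\xi^1,\xi^2)$. Let $g_{\alpha\beta}=\langle\partial_\alpha\Phi,\partial_\beta\Phi\rangle$ be the metric of the unit sphere, with inverse $g^{\alpha\beta}$, determinant $g$, and covariant derivative $(\cdot)_{||\beta}$. On the cone $C=\{(\xi^1,\xi^2,r):\xi\in U,\ r>0\}$ use the coordinates $x=(\xi^1,\xi^2,r)$ of the point $r\,\Phi(\xi)$ of Euclidean 3-space; let $G_{ij}$ be the Euclidean metric in these coordinates, with inverse $G^{ij}$, determinant $G$, and covariant derivative $(\cdot)_{|j}$. Covariant derivatives of relative tensors are taken according to weight: with Christoffel symbols $\Gamma^i_{jk}$, a contravariant relative vector of weight $w$ has $W^i_{|k}=\partial_kW^i+\Gamma^i_{hk}W^h-w\,\Gamma^l_{lk}W^i$, and similarly for rank 2. Expressions carrying a factor $\sqrt G$ or $\sqrt g$ have weight $1$, the others weight $0$.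 Let $\mu\ne0$ be a constant and let $P=P(\rho,e)$ be a gas law that is $C^1$ on an open set $D\subset\mathbb R^2$. Let $\rho,e$ (scalars) and $V^i,B^i$ (contravariant components of vectors) be $C^1$ on $C$, with $(\rho,e)\in D$. Put $|\pmb B|^2=G_{ij}B^iB^j$, $\pmb V\cdot\pmb B=G_{ij}V^iB^j$, $E=e+\tfrac12G_{ij}V^iV^j$. The steady 3D ideal MHD equations with Powell source terms are $$\left(\rho\sqrt GV^j\right)_{|j}=0,\tag{S1}$$ $$\left(\sqrt G\left[\rho V^iV^j-\tfrac1\mu B^iB^j+G^{ij}\left(P+\tfrac{|\pmb B|^2}{2\mu}\right)\right]\right)_{|j}=-\tfrac{\sqrt G}{\mu}B^iB^j_{|j},\tag{S2}$$ $$\left(\sqrt G\left[\left(\rho E+P+\tfrac{|\pmb B|^2}{\mu}\right)V^j-\tfrac1\mu(\pmb V\cdot\pmb B)B^j\right]\right)_{|j}=-\tfrac{\sqrt G}{\mu}(\pmb V\cdot\pmb B)B^j_{|j},\tag{S3}$$ $$\left(V^jB^i-V^iB^j\right)_{|j}=-V^iB^j_{|j}.\tag{S4}$$ The state $(\rho,e,\pmb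 V,\pmb B)$ is *conical* if the covariant derivative of every dependent variable in the direction of $r$ vanishes on $C$: $\partial_r\rho=\partial_re=0$, $V^i_{|3}=B^i_{|3}=0$ for all $i$. The *rescaled* components are $v^\alpha=rV^\alpha$, $b^\alpha=rB^\alpha$. **Claim.** (a) If the state is conical, then $\rho,e,v^\alpha,V^3,b^\alpha,B^3$ do not depend on $r$, so they are $C^1$ functions of $\xi\in U$. Conversely, all $C^1$ functions $\rho,e,v^\alpha,V^3,b^\alpha,B^3$ on $U$ with $(\rho,e)\in D$ arise in this way from a conical $C^1$ state on $C$. (b) For a conical state, at every point of $C$, $$B^j_{|j}=\frac{b^\beta_{||\beta}+2B^3}{r}.$$ (c) For a conical state, (S1)–(S4) hold on $C$ if and only if the following eight equations hold on $U$, where $v_c^2=g_{\alpha\beta}v^\alpha v^\beta$, $b_c^2=g_{\alpha\beta}b^\alpha b^\beta$, $|\pmb B|^2=b_c^2+(B^3)^2$, $\pmb V\cdot\pmb B=g_{\alpha\beta}v^\alpha b^\beta+V^3B^3$, $E=e+\tfrac12\left(v_c^2+(V^3)^2\right)$: $$\frac{\partial}{\partial\xi^\beta}\left(\rho\sqrt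 gv^\beta\right)+2\rho\sqrt gV^3=0,\tag{C1}$$ $$\left[\sqrt g\left(\rho v^\alpha v^\beta-\tfrac1\mu b^\alpha b^\beta+g^{\alpha\beta}\left[P+\tfrac{|\pmb B|^2}{2\mu}\right]\right)\right]_{||\beta}+3\sqrt g\left(\rho v^\alpha V^3-\tfrac1\mu b^\alpha B^3\right)=-\tfrac{\sqrt g}{\mu}b^\alpha\left(b^\nu_{||\nu}+2B^3\right),\tag{C2}$$ $$\frac{\partial}{\partial\xi^\alpha}\left(\rho\sqrt gV^3v^\alpha-\tfrac{\sqrt g}{\mu}B^3b^\alpha\right)+2\sqrt g\left(\rho(V^3)^2-\tfrac1\mu(B^3)^2\right)-\rho\sqrt gv_c^2+\tfrac{\sqrt g}{\mu}b_c^2=-\tfrac{\sqrt g}{\mu}B^3\left(b^\nu_{||\nu}+2B^3\right),\tag{C3}$$ $$\begin{aligned}&\frac{\partial}{\partial\xi^\beta}\left(\sqrt g\left[\left(\rho E+P+\tfrac{|\pmb B|^2}{\mu}\right)v^\beta-\tfrac1\mu(\pmb V\cdot\pmb B)b^\beta\right]\right)+2\sqrt g\left[\left(\rho E+P+\tfrac{|\pmb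 B|^2}{\mu}\right)V^3-\tfrac1\mu(\pmb V\cdot\pmb B)B^3\right]\\&\qquad=-\tfrac{\sqrt g}{\mu}(\pmb V\cdot\pmb B)\left(b^\nu_{||\nu}+2B^3\right),\end{aligned}\tag{C4}$$ $$\left(v^\beta b^\alpha-v^\alpha b^\beta\right)_{||\beta}+\left(V^3b^\alpha-v^\alpha B^3\right)=-v^\alpha\left(b^\nu_{||\nu}+2B^3\right),\tag{C5}$$ $$\frac{\partial}{\partial\xi^\beta}\left(v^\beta B^3-V^3b^\beta\right)+\left(v^\beta B^3-V^3b^\beta\right)\frac1{\sqrt g}\frac{\partial\sqrt g}{\partial\xi^\beta}=-V^3\left(b^\nu_{||\nu}+2B^3\right).\tag{C6}$$ The equivalence also holds equation by equation and point by point: for all $\xi\in U$ and $r>0$, (S1), (S2) with $i=\alpha$, (S2) with $i=3$, (S3), (S4) with $i=\alpha$, (S4) with $i=3$ at $(\xi,r)$ are equivalent to (C1), (C2), (C3), (C4), (C5), (C6) at $\xi$, respectively. -/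

import Mathlib

noncomputable section

namespace ConicalMHD

/-! ### Tensor calculus in coordinates

Points of an `n`-dimensional coordinate domain are `x : Fin n → ℝ`; a metric is a field of
`n × n` matrices; contravariant tensors are given by their components. -/

/-- The partial derivative `∂f/∂xⁱ` at `x`. -/
def pd {n : ℕ} (i : Fin n) (f : (Fin n → ℝ) → ℝ) (x : Fin n → ℝ) : ℝ :=
  fderiv ℝ f x (Pi.single i 1)

/-- A metric tensor (covariant components), as a function of the coordinates. -/
abbrev MetricField (n : ℕ) := (Fin n → ℝ) → Matrix (Fin n) (Fin n) ℝ

/-- The metric `⟨∂X/∂xⁱ, ∂X/∂xʲ⟩` induced from Euclidean 3-space by a map `X`, written in the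
coordinates `x`. -/
def inducedMetric {n : ℕ} (X : (Fin n → ℝ) → EuclideanSpace ℝ (Fin 3)) : MetricField n :=
  fun x => Matrix.of fun i j =>
    inner ℝ (fderiv ℝ X x (Pi.single i 1)) (fderiv ℝ X x (Pi.single j 1))

/-- The square root of the determinant of the metric. -/
def sqrtDet {n : ℕ} (g : MetricField n) (x : Fin n → ℝ) : ℝ := Real.sqrt (g x).det

/-- The scalar product `g_{ij} uⁱ wʲ`. -/
def dot {n : ℕ} (g : MetricField n) (x : Fin n → ℝ) (u w : Fin n → ℝ) : ℝ :=
  ∑ i, ∑ j, g x i j * u i * w j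

/-- The Christoffel symbol `Γ^i_{jk}` of the metric `g`, with upper index `i`. -/
def christoffel {n : ℕ} (g : MetricField n) (x : Fin n → ℝ) (i j k : Fin n) : ℝ :=
  ∑ l, (g x)⁻¹ i l / 2 *
    (pd k (fun y => g y l j) x + pd j (fun y => g y l k) x - pd l (fun y => g y j k) x)

/-- The covariant derivative `Wⁱ_{|k}` of a contravariant relative vector `W` of weight `w`
(`w = 0` for an ordinary vector). -/
def covDerivVec {n : ℕ} (g : MetricField n) (w : ℝ) (W : (Fin n → ℝ) → Fin n → ℝ)
    (x : Fin n → ℝ) (i k : Fin n) : ℝ :=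
  pd k (fun y => W y i) x + ∑ h, christoffel g x i h k * W x h
    - w * (∑ l, christoffel g x l l k) * W x i

/-- The contracted covariant derivative `Wʲ_{|j}` of a contravariant relative vector. -/
def divVec {n : ℕ} (g : MetricField n) (w : ℝ) (W : (Fin n → ℝ) → Fin n → ℝ)
    (x : Fin n → ℝ) : ℝ :=
  ∑ j, covDerivVec g w W x j j

/-- The covariant derivative `W^{ij}_{|k}` of a contravariant relative tensor `W` of rank 2 and
weight `w` (`w = 0` for an ordinary tensor). -/
def covDerivTensor {n : ℕ} (g : MetricField n) (w : ℝ) (W : (Fin n → ℝ) → Fin n → Fin n → ℝ)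
    (x : Fin n → ℝ) (i j k : Fin n) : ℝ :=
  pd k (fun y => W y i j) x + ∑ h, christoffel g x i h k * W x h j
    + ∑ h, christoffel g x j h k * W x i h - w * (∑ l, christoffel g x l l k) * W x i j

/-- The contracted covariant derivative `W^{ij}_{|j}` of a contravariant relative tensor of
rank 2. -/
def divTensor {n : ℕ} (g : MetricField n) (w : ℝ) (W : (Fin n → ℝ) → Fin n → Fin n → ℝ)
    (x : Fin n → ℝ) (i : Fin n) : ℝ :=
  ∑ j, covDerivTensor g w W x i j j

/-! ### Coordinates on the unit sphere and the adapted coordinates of 3-space -/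

/-- `Φ` parametrizes (an open part of) the unit sphere by surface coordinates
`ξ = (ξ¹, ξ²)` ranging over the open set `U`. -/
structure IsSphereChart (Φ : (Fin 2 → ℝ) → EuclideanSpace ℝ (Fin 3)) (U : Set (Fin 2 → ℝ)) :
    Prop where
  isOpen : IsOpen U
  contDiffOn : ContDiffOn ℝ 2 Φ U
  norm_eq_one : ∀ ξ ∈ U, ‖Φ ξ‖ = 1
  injOn : Set.InjOn Φ U
  immersion : ∀ ξ ∈ U, Function.Injective (fderiv ℝ Φ ξ)

/-- The coordinates `x = (ξ¹, ξ², r)`. The surface index `α : Fin 2` is the space index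
`α.castSucc`, and the radial index (the third one) is `2 : Fin 3`. -/
def pt (ξ : Fin 2 → ℝ) (r : ℝ) : Fin 3 → ℝ := ![ξ 0, ξ 1, r]

/-- The cone over `U`: all `(ξ¹, ξ², r)` with `ξ ∈ U` and `r > 0`. -/
def cone (U : Set (Fin 2 → ℝ)) : Set (Fin 3 → ℝ) := {x | ![x 0, x 1] ∈ U ∧ 0 < x 2}

/-- The position `r Φ(ξ)` in Euclidean 3-space of the point with coordinates
`(ξ¹, ξ², r)`. -/
def position (Φ : (Fin 2 → ℝ) → EuclideanSpace ℝ (Fin 3)) (x : Fin 3 → ℝ) :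
    EuclideanSpace ℝ (Fin 3) :=
  x 2 • Φ ![x 0, x 1]

/-- The metric `g_{αβ}` of the unit sphere in the coordinates `(ξ¹, ξ²)`. -/
def sphereMetric (Φ : (Fin 2 → ℝ) → EuclideanSpace ℝ (Fin 3)) : MetricField 2 :=
  inducedMetric Φ

/-- The metric `G_{ij}` of Euclidean 3-space in the coordinates `(ξ¹, ξ², r)`. -/
def spaceMetric (Φ : (Fin 2 → ℝ) → EuclideanSpace ℝ (Fin 3)) : MetricField 3 :=
  inducedMetric (position Φ)

/-! ### The steady ideal MHD equations in 3-space -/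

/-- The dependent variables in 3-space: density, specific thermal energy, and the contravariant
components of velocity and magnetic field, as functions of `(ξ¹, ξ², r)`. -/
structure SpaceState where
  ρ : (Fin 3 → ℝ) → ℝ
  e : (Fin 3 → ℝ) → ℝ
  V : (Fin 3 → ℝ) → Fin 3 → ℝ
  B : (Fin 3 → ℝ) → Fin 3 → ℝ

namespace SpaceState

/-- Continuously differentiable fields on the cone, with thermodynamic states `(ρ, e)` in the
domain `D` of the gas law. -/
structure IsRegular (S : SpaceState) (U : Set (Fin 2 → ℝ)) (D : Set (ℝ × ℝ)) : Prop where
  ρ : ContDiffOn ℝ 1 S.ρ (cone U)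
  e : ContDiffOn ℝ 1 S.e (cone U)
  V : ContDiffOn ℝ 1 S.V (cone U)
  B : ContDiffOn ℝ 1 S.B (cone U)
  mem : ∀ x ∈ cone U, (S.ρ x, S.e x) ∈ D

/-- All dependent variables are conical: the covariant derivative in the direction of `r`
vanishes on the cone. -/
structure IsConical (S : SpaceState) (Φ : (Fin 2 → ℝ) → EuclideanSpace ℝ (Fin 3))
    (U : Set (Fin 2 → ℝ)) : Prop where
  ρ : ∀ x ∈ cone U, pd 2 S.ρ x = 0
  e : ∀ x ∈ cone U, pd 2 S.e x = 0
  V : ∀ x ∈ cone U, ∀ i, covDerivVec (spaceMetric Φ) 0 S.V x i 2 = 0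
  B : ∀ x ∈ cone U, ∀ i, covDerivVec (spaceMetric Φ) 0 S.B x i 2 = 0

variable (S : SpaceState) (G : MetricField 3) (μ : ℝ) (P : ℝ × ℝ → ℝ)

/-- The total specific energy `E = e + |V|²/2`. -/
def energy (x : Fin 3 → ℝ) : ℝ := S.e x + dot G x (S.V x) (S.V x) / 2

/-- The pressure `P = P(ρ, e)`. -/
def pressure (x : Fin 3 → ℝ) : ℝ := P (S.ρ x, S.e x)

/-- `B^j_{|j}`. -/
def divB (x : Fin 3 → ℝ) : ℝ := divVec G 0 S.B x

/-- `ρ √G V^j`. -/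
def massFlux (x : Fin 3 → ℝ) (j : Fin 3) : ℝ := S.ρ x * sqrtDet G x * S.V x j

/-- `√G [ρ Vⁱ Vʲ - Bⁱ Bʲ / μ + G^{ij} (P + |B|² / (2μ))]`. -/
def momentumFlux (x : Fin 3 → ℝ) (i j : Fin 3) : ℝ :=
  sqrtDet G x * (S.ρ x * S.V x i * S.V x j - 1 / μ * S.B x i * S.B x j
    + (G x)⁻¹ i j * (S.pressure P x + dot G x (S.B x) (S.B x) / (2 * μ)))

/-- `√G [(ρ E + P + |B|² / μ) Vʲ - (V · B) Bʲ / μ]`. -/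
def energyFlux (x : Fin 3 → ℝ) (j : Fin 3) : ℝ :=
  sqrtDet G x * ((S.ρ x * S.energy G x + S.pressure P x + dot G x (S.B x) (S.B x) / μ) * S.V x j
    - 1 / μ * dot G x (S.V x) (S.B x) * S.B x j)

/-- `Vʲ Bⁱ - Vⁱ Bʲ`. -/
def magneticFlux (x : Fin 3 → ℝ) (i j : Fin 3) : ℝ := S.V x j * S.B x i - S.V x i * S.B x j

/-- The mass equation at `x`. -/
def MassEq (x : Fin 3 → ℝ) : Prop := divVec G 1 (S.massFlux G) x = 0

/-- The `i`-th momentum equation at `x`, with Powell source term. -/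
def MomentumEq (x : Fin 3 → ℝ) (i : Fin 3) : Prop :=
  divTensor G 1 (S.momentumFlux G μ P) x i = -(sqrtDet G x / μ) * S.B x i * S.divB G x

/-- The energy equation at `x`, with Powell source term. -/
def EnergyEq (x : Fin 3 → ℝ) : Prop :=
  divVec G 1 (S.energyFlux G μ P) x =
    -(sqrtDet G x / μ) * dot G x (S.V x) (S.B x) * S.divB G x

/-- The `i`-th magnetic equation at `x`, with Powell source term. -/
def MagneticEq (x : Fin 3 → ℝ) (i : Fin 3) : Prop :=
  divTensor G 0 S.magneticFlux x i = -S.V x i * S.divB G x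

/-- The steady 3D ideal MHD equations with Powell source terms, at `x`. -/
structure SteadyMHDAt (x : Fin 3 → ℝ) : Prop where
  mass : S.MassEq G x
  momentum : ∀ i, S.MomentumEq G μ P x i
  energy : S.EnergyEq G μ P x
  magnetic : ∀ i, S.MagneticEq G x i

end SpaceState

/-! ### The conical equations on the unit sphere -/

/-- The dependent variables on the unit sphere, as functions of `(ξ¹, ξ²)`: density, specific
thermal energy, rescaled surface components `v^α`, `b^α` and radial components `V3`, `B3` of
velocity and magnetic field. -/
structure SurfaceState where
  ρ : (Fin 2 → ℝ) → ℝ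
  e : (Fin 2 → ℝ) → ℝ
  v : (Fin 2 → ℝ) → Fin 2 → ℝ
  V3 : (Fin 2 → ℝ) → ℝ
  b : (Fin 2 → ℝ) → Fin 2 → ℝ
  B3 : (Fin 2 → ℝ) → ℝ

namespace SurfaceState

/-- Continuously differentiable fields on `U`, with thermodynamic states `(ρ, e)` in the domain
`D` of the gas law. -/
structure IsRegular (s : SurfaceState) (U : Set (Fin 2 → ℝ)) (D : Set (ℝ × ℝ)) : Prop where
  ρ : ContDiffOn ℝ 1 s.ρ U
  e : ContDiffOn ℝ 1 s.e U
  v : ContDiffOn ℝ 1 s.v U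
  V3 : ContDiffOn ℝ 1 s.V3 U
  b : ContDiffOn ℝ 1 s.b U
  B3 : ContDiffOn ℝ 1 s.B3 U
  mem : ∀ ξ ∈ U, (s.ρ ξ, s.e ξ) ∈ D

variable (s : SurfaceState) (g : MetricField 2) (μ : ℝ) (P : ℝ × ℝ → ℝ)

/-- `|V|²`, the square of the length of the whole velocity vector. -/
def normSqV (ξ : Fin 2 → ℝ) : ℝ := dot g ξ (s.v ξ) (s.v ξ) + s.V3 ξ ^ 2

/-- `|B|²`, the square of the length of the whole magnetic field vector. -/
def normSqB (ξ : Fin 2 → ℝ) : ℝ := dot g ξ (s.b ξ) (s.b ξ) + s.B3 ξ ^ 2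

/-- `V · B`. -/
def dotVB (ξ : Fin 2 → ℝ) : ℝ := dot g ξ (s.v ξ) (s.b ξ) + s.V3 ξ * s.B3 ξ

/-- The magnitude `v_c` of the surface velocity. -/
def vc (ξ : Fin 2 → ℝ) : ℝ := Real.sqrt (dot g ξ (s.v ξ) (s.v ξ))

/-- The magnitude `b_c` of the surface magnetic field. -/
def bc (ξ : Fin 2 → ℝ) : ℝ := Real.sqrt (dot g ξ (s.b ξ) (s.b ξ))

/-- The total specific energy `E = e + |V|²/2`. -/
def energy (ξ : Fin 2 → ℝ) : ℝ := s.e ξ + s.normSqV g ξ / 2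

/-- The pressure `P = P(ρ, e)`. -/
def pressure (ξ : Fin 2 → ℝ) : ℝ := P (s.ρ ξ, s.e ξ)

/-- The factor `b^ν_{||ν} + 2 B³` of the source terms. -/
def source (ξ : Fin 2 → ℝ) : ℝ := divVec g 0 s.b ξ + 2 * s.B3 ξ

/-- `√g (ρ v^α v^β - b^α b^β / μ + g^{αβ} [P + |B|² / (2μ)])`. -/
def momentumFlux (ξ : Fin 2 → ℝ) (α β : Fin 2) : ℝ :=
  sqrtDet g ξ * (s.ρ ξ * s.v ξ α * s.v ξ β - 1 / μ * s.b ξ α * s.b ξ β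
    + (g ξ)⁻¹ α β * (s.pressure P ξ + s.normSqB g ξ / (2 * μ)))

/-- `v^β b^α - v^α b^β`. -/
def magneticFlux (ξ : Fin 2 → ℝ) (α β : Fin 2) : ℝ := s.v ξ β * s.b ξ α - s.v ξ α * s.b ξ β

/-- The mass equation at `ξ`. -/
def MassEq (ξ : Fin 2 → ℝ) : Prop :=
  ∑ β, pd β (fun η => s.ρ η * sqrtDet g η * s.v η β) ξ + 2 * s.ρ ξ * sqrtDet g ξ * s.V3 ξ = 0

/-- The `α`-th surface momentum equation at `ξ`. -/
def MomentumEq (ξ : Fin 2 → ℝ) (α : Fin 2) : Prop :=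
  divTensor g 1 (s.momentumFlux g μ P) ξ α
    + 3 * (sqrtDet g ξ * (s.ρ ξ * s.v ξ α * s.V3 ξ - 1 / μ * s.b ξ α * s.B3 ξ))
    = -(sqrtDet g ξ / μ) * s.b ξ α * s.source g ξ

/-- The third momentum equation at `ξ`. -/
def Momentum3Eq (ξ : Fin 2 → ℝ) : Prop :=
  ∑ α, pd α (fun η => s.ρ η * sqrtDet g η * s.V3 η * s.v η α
      - sqrtDet g η / μ * s.B3 η * s.b η α) ξ
    + 2 * sqrtDet g ξ * (s.ρ ξ * s.V3 ξ ^ 2 - 1 / μ * s.B3 ξ ^ 2)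
    - s.ρ ξ * sqrtDet g ξ * s.vc g ξ ^ 2 + sqrtDet g ξ / μ * s.bc g ξ ^ 2
    = -(sqrtDet g ξ / μ) * s.B3 ξ * s.source g ξ

/-- The energy equation at `ξ`. -/
def EnergyEq (ξ : Fin 2 → ℝ) : Prop :=
  ∑ β, pd β (fun η => sqrtDet g η *
      ((s.ρ η * s.energy g η + s.pressure P η + s.normSqB g η / μ) * s.v η β
        - 1 / μ * s.dotVB g η * s.b η β)) ξ
    + 2 * sqrtDet g ξ *
      ((s.ρ ξ * s.energy g ξ + s.pressure P ξ + s.normSqB g ξ / μ) * s.V3 ξ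
        - 1 / μ * s.dotVB g ξ * s.B3 ξ)
    = -(sqrtDet g ξ / μ) * s.dotVB g ξ * s.source g ξ

/-- The `α`-th surface magnetic equation at `ξ`. -/
def MagneticEq (ξ : Fin 2 → ℝ) (α : Fin 2) : Prop :=
  divTensor g 0 s.magneticFlux ξ α + (s.V3 ξ * s.b ξ α - s.v ξ α * s.B3 ξ)
    = -s.v ξ α * s.source g ξ

/-- The third magnetic equation at `ξ`. -/
def Magnetic3Eq (ξ : Fin 2 → ℝ) : Prop :=
  ∑ β, pd β (fun η => s.v η β * s.B3 η - s.V3 η * s.b η β) ξ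
    + ∑ β, (s.v ξ β * s.B3 ξ - s.V3 ξ * s.b ξ β) * (1 / sqrtDet g ξ) * pd β (sqrtDet g) ξ
    = -s.V3 ξ * s.source g ξ

/-- The system of eight conical MHD equations at `ξ`. -/
structure ConicalMHDAt (ξ : Fin 2 → ℝ) : Prop where
  mass : s.MassEq g ξ
  momentum : ∀ α, s.MomentumEq g μ P ξ α
  momentum3 : s.Momentum3Eq g μ ξ
  energy : s.EnergyEq g μ P ξ
  magnetic : ∀ α, s.MagneticEq g ξ α
  magnetic3 : s.Magnetic3Eq g ξ

end SurfaceState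

/-- `s` is the rescaled form of `S` over `U`, at every radius `r > 0`: scalars and radial
components agree, and surface components are related by `v^α = r V^α`, `b^α = r B^α`.
In particular the rescaled components of `S` do not depend on `r`. -/
structure RescalesTo (S : SpaceState) (s : SurfaceState) (U : Set (Fin 2 → ℝ)) : Prop where
  ρ : ∀ ξ ∈ U, ∀ r : ℝ, 0 < r → s.ρ ξ = S.ρ (pt ξ r)
  e : ∀ ξ ∈ U, ∀ r : ℝ, 0 < r → s.e ξ = S.e (pt ξ r)
  v : ∀ ξ ∈ U, ∀ r : ℝ, 0 < r → ∀ α : Fin 2, s.v ξ α = r * S.V (pt ξ r) α.castSucc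
  V3 : ∀ ξ ∈ U, ∀ r : ℝ, 0 < r → s.V3 ξ = S.V (pt ξ r) 2
  b : ∀ ξ ∈ U, ∀ r : ℝ, 0 < r → ∀ α : Fin 2, s.b ξ α = r * S.B (pt ξ r) α.castSucc
  B3 : ∀ ξ ∈ U, ∀ r : ℝ, 0 < r → s.B3 ξ = S.B (pt ξ r) 2

end ConicalMHD

end

/-! The position vector `r Φ` has unit radial derivative `Φ`, orthogonal to the tangent plane of the
sphere, so the Euclidean metric is `r² g_{αβ} dξ^α dξ^β + dr²`. Hence `√G = r² √g`, and the nonzero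
Christoffel symbols are among those of the sphere, `Γ^α_{β3} = δ^α_β / r` and `Γ^3_{αβ} = -r
g_{αβ}`.

Consequently `W^α_{|3} = (1/r) ∂_r (r W^α)` and `W^3_{|3} = ∂_r W^3`: being conical means exactly
that the rescaled components are constant along rays, which gives part (a).

For a conical state every flux component is a power of `r` times a function of `ξ`, and each radial
index raises the exponent by one. The divergence of such a field is one power of `r` times a sphere
divergence plus zeroth-order terms. Those terms come from differentiating the power of `r` and from
the two families of symbols above. This is the content of `divVec_of_homogeneous`,
`divTensor_castSucc_of_homogeneous` and `divTensor_two_of_homogeneous`. The first also gives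
`B^j_{|j}`, of degree `-1`, so in each equation flux divergence and Powell source carry the same
power of `r`. Cancelling it yields the surface equation, at each point and for each equation
separately. -/

noncomputable section
namespace ConicalMHD

open Topology

/-! ### The cone and its projection to the surface coordinates -/

/-- The projection `(ξ¹, ξ², r) ↦ (ξ¹, ξ²)`. -/
def surfaceProj : (Fin 3 → ℝ) →L[ℝ] (Fin 2 → ℝ) :=
  ContinuousLinearMap.pi fun α => ContinuousLinearMap.proj α.castSucc

@[simp] theorem surfaceProj_apply (x : Fin 3 → ℝ) (α : Fin 2) :
    surfaceProj x α = x α.castSucc := rfl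

/-- `cone` and `position` are defined with the literal vector; the continuous linear form gives
access to the chain rule. -/
theorem vec_eq_surfaceProj (x : Fin 3 → ℝ) : ![x 0, x 1] = surfaceProj x := by
  ext α; fin_cases α <;> rfl

@[simp] theorem surfaceProj_pt (ξ : Fin 2 → ℝ) (r : ℝ) : surfaceProj (pt ξ r) = ξ := by
  ext α; fin_cases α <;> rfl

@[simp] theorem pt_two (ξ : Fin 2 → ℝ) (r : ℝ) : pt ξ r 2 = r := rfl

theorem pt_surfaceProj (x : Fin 3 → ℝ) : pt (surfaceProj x) (x 2) = x := by
  ext i; fin_cases i <;> rfl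

@[simp] theorem surfaceProj_single_castSucc (α : Fin 2) :
    surfaceProj (Pi.single α.castSucc 1) = Pi.single α 1 := by
  ext β; fin_cases α <;> fin_cases β <;> simp

@[simp] theorem surfaceProj_single_two : surfaceProj (Pi.single 2 1) = 0 := by
  ext β; fin_cases β <;> simp

theorem single_castSucc_two (α : Fin 2) : (Pi.single α.castSucc 1 : Fin 3 → ℝ) 2 = 0 := by
  fin_cases α <;> simp

theorem mem_cone {U : Set (Fin 2 → ℝ)} {x : Fin 3 → ℝ} :
    x ∈ cone U ↔ surfaceProj x ∈ U ∧ 0 < x 2 := by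
  rw [← vec_eq_surfaceProj]; rfl

theorem pt_mem_cone {U : Set (Fin 2 → ℝ)} {ξ : Fin 2 → ℝ} (hξ : ξ ∈ U) {r : ℝ} (hr : 0 < r) :
    pt ξ r ∈ cone U := mem_cone.2 (by simpa using ⟨hξ, hr⟩)

theorem isOpen_cone {U : Set (Fin 2 → ℝ)} (hU : IsOpen U) : IsOpen (cone U) := by
  have : cone U = surfaceProj ⁻¹' U ∩ {x | 0 < x 2} := by ext; exact mem_cone
  rw [this]
  exact (hU.preimage surfaceProj.continuous).inter
    (isOpen_lt continuous_const (continuous_apply 2))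

/-- Index computations separate surface indices from the radial one; `2 : Fin 3` is definitionally
`Fin.last 2`. -/
theorem sum_space (f : Fin 3 → ℝ) : ∑ i, f i = ∑ α : Fin 2, f α.castSucc + f 2 :=
  Fin.sum_univ_castSucc f

theorem forall_space {p : Fin 3 → Prop} : (∀ i, p i) ↔ (∀ α : Fin 2, p α.castSucc) ∧ p 2 := by
  rw [Fin.forall_fin_succ', Fin.last]; rfl

/-! ### Partial derivatives of fields homogeneous in the radius -/

theorem pd_congr_of_eqOn {n : ℕ} {s : Set (Fin n → ℝ)} (hs : IsOpen s) {f h : (Fin n → ℝ) → ℝ}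
    (hfh : Set.EqOn f h s) {x : Fin n → ℝ} (hx : x ∈ s) (i : Fin n) : pd i f x = pd i h x := by
  rw [pd, pd, (hfh.eventuallyEq_of_mem (hs.mem_nhds hx)).fderiv_eq]

theorem pd_zero {n : ℕ} (i : Fin n) (x : Fin n → ℝ) : pd i (fun _ => 0) x = 0 := by
  simp [pd]

/-- Integer exponents are needed because the fields on the cone have degrees from `-2` (magnetic
flux) to `2` (metric, `√G`). -/
theorem hasFDerivAt_zpow_mul_comp {f : (Fin 2 → ℝ) → ℝ} {k : ℤ} {x : Fin 3 → ℝ}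
    (hx : x 2 ≠ 0) (hf : DifferentiableAt ℝ f (surfaceProj x)) :
    HasFDerivAt (fun y : Fin 3 → ℝ => y 2 ^ k * f (surfaceProj y))
      (x 2 ^ k • (fderiv ℝ f (surfaceProj x)).comp surfaceProj + f (surfaceProj x) •
        (k * x 2 ^ (k - 1)) • ContinuousLinearMap.proj (R := ℝ) (φ := fun _ : Fin 3 => ℝ) 2) x := by
  have h1 : HasFDerivAt (fun y : Fin 3 → ℝ => y 2)
      (ContinuousLinearMap.proj (R := ℝ) (φ := fun _ : Fin 3 => ℝ) 2) x := hasFDerivAt_apply 2 x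
  exact ((hasDerivAt_zpow k (x 2) (Or.inl hx)).comp_hasFDerivAt x h1).mul
    (hf.hasFDerivAt.comp x surfaceProj.hasFDerivAt)

section

variable {U : Set (Fin 2 → ℝ)} {F : (Fin 3 → ℝ) → ℝ} {f : (Fin 2 → ℝ) → ℝ} {k : ℤ}

theorem pd_castSucc_of_homogeneous (hU : IsOpen U)
    (hF : ∀ x ∈ cone U, F x = x 2 ^ k * f (surfaceProj x)) {ξ : Fin 2 → ℝ} (hξ : ξ ∈ U)
    (hf : DifferentiableAt ℝ f ξ) {r : ℝ} (hr : 0 < r) (α : Fin 2) :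
    pd α.castSucc F (pt ξ r) = r ^ k * pd α f ξ := by
  rw [pd_congr_of_eqOn (isOpen_cone hU) hF (pt_mem_cone hξ hr), pd,
    (hasFDerivAt_zpow_mul_comp (by simpa using hr.ne') (by simpa using hf)).fderiv]
  simp [pd, single_castSucc_two]

theorem pd_two_of_homogeneous (hU : IsOpen U)
    (hF : ∀ x ∈ cone U, F x = x 2 ^ k * f (surfaceProj x)) {ξ : Fin 2 → ℝ} (hξ : ξ ∈ U)
    (hf : DifferentiableAt ℝ f ξ) {r : ℝ} (hr : 0 < r) :
    pd 2 F (pt ξ r) = k * r ^ (k - 1) * f ξ := by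
  rw [pd_congr_of_eqOn (isOpen_cone hU) hF (pt_mem_cone hξ hr), pd,
    (hasFDerivAt_zpow_mul_comp (by simpa using hr.ne') (by simpa using hf)).fderiv]
  simp [mul_comm]

end

theorem hasDerivAt_pt (ξ : Fin 2 → ℝ) (r : ℝ) :
    HasDerivAt (pt ξ) (Pi.single 2 1) r := by
  rw [hasDerivAt_pi]
  intro i
  fin_cases i
  · simpa [pt] using hasDerivAt_const r (ξ 0)
  · simpa [pt] using hasDerivAt_const r (ξ 1)
  · simpa [pt] using hasDerivAt_id' r

/-- A field whose radial derivative vanishes on the cone is constant along rays. -/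
theorem eq_of_pd_two_eq_zero {U : Set (Fin 2 → ℝ)} (hU : IsOpen U) {F : (Fin 3 → ℝ) → ℝ}
    (hF : ContDiffOn ℝ 1 F (cone U)) (h0 : ∀ x ∈ cone U, pd 2 F x = 0) {ξ : Fin 2 → ℝ}
    (hξ : ξ ∈ U) {r : ℝ} (hr : 0 < r) : F (pt ξ 1) = F (pt ξ r) := by
  have hd : ∀ t ∈ Set.Ioi (0 : ℝ), HasDerivAt (fun t => F (pt ξ t)) 0 t := by
    intro t ht
    have hx := pt_mem_cone hξ ht
    have h := ((hF.differentiableOn one_ne_zero).differentiableAt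
      ((isOpen_cone hU).mem_nhds hx)).hasFDerivAt.comp_hasDerivAt t (hasDerivAt_pt ξ t)
    have h' : (fderiv ℝ F (pt ξ t)) (Pi.single 2 1) = 0 := h0 _ hx
    rwa [h'] at h
  exact isOpen_Ioi.is_const_of_deriv_eq_zero isPreconnected_Ioi
    (fun t ht => (hd t ht).differentiableAt.differentiableWithinAt)
    (fun t ht => (hd t ht).deriv) (Set.mem_Ioi.2 one_pos) (Set.mem_Ioi.2 hr)

theorem contDiff_pt_one : ContDiff ℝ 1 fun ξ => pt ξ 1 := by
  rw [contDiff_pi]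
  intro i
  fin_cases i
  · exact contDiff_apply ℝ ℝ (0 : Fin 2)
  · exact contDiff_apply ℝ ℝ (1 : Fin 2)
  · exact contDiff_const

theorem contDiffOn_comp_pt_one {E : Type*} [NormedAddCommGroup E] [NormedSpace ℝ E]
    {U : Set (Fin 2 → ℝ)} {F : (Fin 3 → ℝ) → E} (hF : ContDiffOn ℝ 1 F (cone U)) :
    ContDiffOn ℝ 1 (fun ξ => F (pt ξ 1)) U :=
  hF.comp contDiff_pt_one.contDiffOn fun _ hξ => pt_mem_cone hξ one_pos

theorem contDiffOn_comp_surfaceProj {E : Type*} [NormedAddCommGroup E] [NormedSpace ℝ E]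
    {U : Set (Fin 2 → ℝ)} {f : (Fin 2 → ℝ) → E} (hf : ContDiffOn ℝ 1 f U) :
    ContDiffOn ℝ 1 (fun x => f (surfaceProj x)) (cone U) :=
  hf.comp surfaceProj.contDiff.contDiffOn fun _ hx => (mem_cone.1 hx).1

/-! ### The metric of the sphere -/

namespace IsSphereChart

variable {Φ : (Fin 2 → ℝ) → EuclideanSpace ℝ (Fin 3)} {U : Set (Fin 2 → ℝ)} {ξ : Fin 2 → ℝ}
  {x : Fin 3 → ℝ}

theorem differentiableAt (h : IsSphereChart Φ U) (hξ : ξ ∈ U) : DifferentiableAt ℝ Φ ξ :=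
  (h.contDiffOn.differentiableOn two_ne_zero).differentiableAt (h.isOpen.mem_nhds hξ)

/-- One derivative is lost: a `C²` chart gives a `C¹` metric, enough for Christoffel symbols and for
differentiating the fluxes once. -/
theorem contDiffOn_metric (h : IsSphereChart Φ U) (α β : Fin 2) :
    ContDiffOn ℝ 1 (fun η => sphereMetric Φ η α β) U := by
  have h1 : ContDiffOn ℝ 1 (fderiv ℝ Φ) U :=
    h.contDiffOn.fderiv_of_isOpen h.isOpen (by norm_num)
  exact (h1.clm_apply contDiffOn_const).inner ℝ (h1.clm_apply contDiffOn_const)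

/-- Differentiate `‖Φ‖² = 1`. This orthogonality removes the mixed components of the metric of the
cone. -/
theorem inner_fderiv (h : IsSphereChart Φ U) (hξ : ξ ∈ U) (u : Fin 2 → ℝ) :
    inner ℝ (Φ ξ) (fderiv ℝ Φ ξ u) = 0 := by
  have h1 := (h.differentiableAt hξ).hasFDerivAt.norm_sq
  have h2 : (fun η => ‖Φ η‖ ^ 2) =ᶠ[𝓝 ξ] fun _ => (1 : ℝ) := by
    filter_upwards [h.isOpen.mem_nhds hξ] with η hη
    rw [h.norm_eq_one η hη, one_pow]
  have h3 := h1.unique ((hasFDerivAt_const (1 : ℝ) ξ).congr_of_eventuallyEq h2)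
  have h4 := congrArg (fun L : (Fin 2 → ℝ) →L[ℝ] ℝ => L u) h3
  simpa using h4

end IsSphereChart

theorem sphereMetric_symm (Φ : (Fin 2 → ℝ) → EuclideanSpace ℝ (Fin 3)) (ξ : Fin 2 → ℝ)
    (α β : Fin 2) : sphereMetric Φ ξ α β = sphereMetric Φ ξ β α := by
  simp only [sphereMetric, inducedMetric, Matrix.of_apply, real_inner_comm]

/-- Exhibits the quadratic form as a squared length, the source of positivity of `det g` and of
`v_c²`, `b_c²`. -/
theorem dot_sphereMetric (Φ : (Fin 2 → ℝ) → EuclideanSpace ℝ (Fin 3)) (ξ u w : Fin 2 → ℝ) :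
    dot (sphereMetric Φ) ξ u w = inner ℝ (fderiv ℝ Φ ξ u) (fderiv ℝ Φ ξ w) := by
  have key : ∀ u : Fin 2 → ℝ, u = u 0 • Pi.single 0 1 + u 1 • Pi.single 1 1 := by
    intro u; ext i; fin_cases i <;> simp
  conv_rhs => rw [key u, key w]
  simp only [map_add, map_smul, inner_add_left, inner_add_right, real_inner_smul_left,
    real_inner_smul_right]
  simp only [dot, sphereMetric, inducedMetric, Matrix.of_apply, Fin.sum_univ_two]
  ring

namespace IsSphereChart

variable {Φ : (Fin 2 → ℝ) → EuclideanSpace ℝ (Fin 3)} {U : Set (Fin 2 → ℝ)} {ξ : Fin 2 → ℝ}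

theorem det_metric_pos (h : IsSphereChart Φ U) (hξ : ξ ∈ U) : 0 < (sphereMetric Φ ξ).det := by
  have hpos : ∀ u : Fin 2 → ℝ, u ≠ 0 → 0 < dot (sphereMetric Φ) ξ u u := by
    intro u hu
    rw [dot_sphereMetric, real_inner_self_eq_norm_sq]
    have : fderiv ℝ Φ ξ u ≠ 0 := fun h0 => hu (h.immersion ξ hξ (by simpa using h0))
    positivity
  set g := sphereMetric Φ ξ with hg
  have hs : g 1 0 = g 0 1 := sphereMetric_symm Φ ξ 1 0
  have h00 := hpos ![1, 0] (fun h0 => by simpa using congrFun h0 0)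
  -- On this vector, orthogonal to the first basis vector, the quadratic form equals `g₀₀ det g`;
  -- with `g₀₀ > 0` this forces `det g > 0`.
  have h11 := hpos ![-g 0 1, g 0 0]
  simp only [dot, Fin.sum_univ_two, ← hg, hs, Matrix.cons_val_zero, Matrix.cons_val_one] at h00 h11
  have h0 : 0 < g 0 0 := by simpa using h00
  have h1 := h11 (fun h' => h0.ne' (by simpa using congrFun h' 1))
  rw [Matrix.det_fin_two, hs]
  by_contra hneg
  nlinarith

theorem metric_mul_inv (h : IsSphereChart Φ U) (hξ : ξ ∈ U) :
    sphereMetric Φ ξ * (sphereMetric Φ ξ)⁻¹ = 1 :=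
  Matrix.mul_nonsing_inv _ (isUnit_iff_ne_zero.2 (h.det_metric_pos hξ).ne')

theorem metric_inv_mul (h : IsSphereChart Φ U) (hξ : ξ ∈ U) :
    (sphereMetric Φ ξ)⁻¹ * sphereMetric Φ ξ = 1 :=
  Matrix.nonsing_inv_mul _ (isUnit_iff_ne_zero.2 (h.det_metric_pos hξ).ne')

theorem sqrtDet_pos (h : IsSphereChart Φ U) (hξ : ξ ∈ U) : 0 < sqrtDet (sphereMetric Φ) ξ :=
  Real.sqrt_pos.2 (h.det_metric_pos hξ)

theorem contDiffOn_det (h : IsSphereChart Φ U) :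
    ContDiffOn ℝ 1 (fun η => (sphereMetric Φ η).det) U := by
  simp only [Matrix.det_fin_two]
  exact ((h.contDiffOn_metric 0 0).mul (h.contDiffOn_metric 1 1)).sub
    ((h.contDiffOn_metric 0 1).mul (h.contDiffOn_metric 1 0))

theorem contDiffOn_sqrtDet (h : IsSphereChart Φ U) :
    ContDiffOn ℝ 1 (sqrtDet (sphereMetric Φ)) U :=
  h.contDiffOn_det.sqrt fun _ hη => (h.det_metric_pos hη).ne'

theorem contDiffOn_metric_inv (h : IsSphereChart Φ U) (α β : Fin 2) :
    ContDiffOn ℝ 1 (fun η => (sphereMetric Φ η)⁻¹ α β) U := by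
  have hd : ContDiffOn ℝ 1 (fun η => ((sphereMetric Φ η).det)⁻¹) U :=
    h.contDiffOn_det.inv fun _ hη => (h.det_metric_pos hη).ne'
  simp only [Matrix.inv_def, Matrix.adjugate_fin_two, Ring.inverse_eq_inv', Matrix.smul_apply,
    smul_eq_mul]
  refine hd.mul ?_
  fin_cases α <;> fin_cases β
  · exact h.contDiffOn_metric 1 1
  · exact (h.contDiffOn_metric 0 1).neg
  · exact (h.contDiffOn_metric 1 0).neg
  · exact h.contDiffOn_metric 0 0

end IsSphereChart

/-! ### The metric of the cone -/

/-- Swapping `j` and `k` exchanges the first two derivatives. The third needs symmetry of `g` as a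
function, since it is differentiated; induced metrics have it at every point. -/
theorem christoffel_symm {n : ℕ} {g : MetricField n} (hg : ∀ x i j, g x i j = g x j i)
    (x : Fin n → ℝ) (i j k : Fin n) : christoffel g x i j k = christoffel g x i k j := by
  have h1 : (fun y => g y j k) = fun y => g y k j := funext fun y => hg y j k
  simp only [christoffel, h1]
  refine Finset.sum_congr rfl fun l _ => ?_
  ring

theorem spaceMetric_symm (Φ : (Fin 2 → ℝ) → EuclideanSpace ℝ (Fin 3)) (x : Fin 3 → ℝ)
    (i j : Fin 3) : spaceMetric Φ x i j = spaceMetric Φ x j i := by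
  simp only [spaceMetric, inducedMetric, Matrix.of_apply, real_inner_comm]

/-- The inverse metric of the cone over a surface with inverse metric `A`, at radius `r`. -/
def coneInverse (A : Matrix (Fin 2) (Fin 2) ℝ) (r : ℝ) : Matrix (Fin 3) (Fin 3) ℝ :=
  Matrix.of (Fin.snoc (fun α => Fin.snoc (fun β => A α β / r ^ 2) 0) (Fin.snoc (fun _ => 0) 1))

theorem coneInverse_castSucc (A : Matrix (Fin 2) (Fin 2) ℝ) (r : ℝ) (α β : Fin 2) :
    coneInverse A r α.castSucc β.castSucc = A α β / r ^ 2 := by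
  simp [coneInverse]

theorem coneInverse_castSucc_two (A : Matrix (Fin 2) (Fin 2) ℝ) (r : ℝ) (α : Fin 2) :
    coneInverse A r α.castSucc 2 = 0 := by
  rw [coneInverse, Matrix.of_apply, Fin.snoc_castSucc]; rfl

theorem coneInverse_two_castSucc (A : Matrix (Fin 2) (Fin 2) ℝ) (r : ℝ) (α : Fin 2) :
    coneInverse A r 2 α.castSucc = 0 := by
  fin_cases α <;> rfl

theorem coneInverse_two_two (A : Matrix (Fin 2) (Fin 2) ℝ) (r : ℝ) :
    coneInverse A r 2 2 = 1 := rfl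

namespace IsSphereChart

variable {Φ : (Fin 2 → ℝ) → EuclideanSpace ℝ (Fin 3)} {U : Set (Fin 2 → ℝ)} {x : Fin 3 → ℝ}

theorem hasFDerivAt_position (h : IsSphereChart Φ U) (hx : x ∈ cone U) :
    HasFDerivAt (position Φ) (x 2 • (fderiv ℝ Φ (surfaceProj x)).comp surfaceProj +
      (ContinuousLinearMap.proj (R := ℝ) (φ := fun _ : Fin 3 => ℝ) 2).smulRight
        (Φ (surfaceProj x))) x := by
  have h1 : HasFDerivAt (fun y : Fin 3 → ℝ => y 2)
      (ContinuousLinearMap.proj (R := ℝ) (φ := fun _ : Fin 3 => ℝ) 2) x := hasFDerivAt_apply 2 x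
  have h2 := (h.differentiableAt (mem_cone.1 hx).1).hasFDerivAt.comp x surfaceProj.hasFDerivAt
  have h3 : position Φ = fun y => y 2 • Φ (surfaceProj y) := by
    funext y; rw [position, vec_eq_surfaceProj]
  rw [h3]
  exact h1.smul h2

theorem fderiv_position_castSucc (h : IsSphereChart Φ U) (hx : x ∈ cone U) (α : Fin 2) :
    fderiv ℝ (position Φ) x (Pi.single α.castSucc 1) =
      x 2 • fderiv ℝ Φ (surfaceProj x) (Pi.single α 1) := by
  simp [(h.hasFDerivAt_position hx).fderiv, single_castSucc_two]

theorem fderiv_position_two (h : IsSphereChart Φ U) (hx : x ∈ cone U) :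
    fderiv ℝ (position Φ) x (Pi.single 2 1) = Φ (surfaceProj x) := by
  simp [(h.hasFDerivAt_position hx).fderiv]

/-- The exponent is an integer so that the statement can serve directly as the homogeneity
hypothesis of the partial-derivative lemmas. -/
theorem spaceMetric_castSucc (h : IsSphereChart Φ U) (hx : x ∈ cone U) (α β : Fin 2) :
    spaceMetric Φ x α.castSucc β.castSucc =
      x 2 ^ (2 : ℤ) * sphereMetric Φ (surfaceProj x) α β := by
  simp only [spaceMetric, sphereMetric, inducedMetric, Matrix.of_apply,
    h.fderiv_position_castSucc hx, real_inner_smul_left, real_inner_smul_right]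
  rw [zpow_ofNat]; ring

theorem spaceMetric_castSucc_two (h : IsSphereChart Φ U) (hx : x ∈ cone U) (α : Fin 2) :
    spaceMetric Φ x α.castSucc 2 = 0 := by
  simp only [spaceMetric, inducedMetric, Matrix.of_apply, h.fderiv_position_castSucc hx,
    h.fderiv_position_two hx, real_inner_smul_left]
  rw [real_inner_comm, h.inner_fderiv (mem_cone.1 hx).1, mul_zero]

theorem spaceMetric_two_castSucc (h : IsSphereChart Φ U) (hx : x ∈ cone U) (α : Fin 2) :
    spaceMetric Φ x 2 α.castSucc = 0 := by
  rw [← h.spaceMetric_castSucc_two hx α]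
  simp only [spaceMetric, inducedMetric, Matrix.of_apply, real_inner_comm]

theorem spaceMetric_two_two (h : IsSphereChart Φ U) (hx : x ∈ cone U) :
    spaceMetric Φ x 2 2 = 1 := by
  simp only [spaceMetric, inducedMetric, Matrix.of_apply, h.fderiv_position_two hx]
  rw [real_inner_self_eq_norm_sq, h.norm_eq_one _ (mem_cone.1 hx).1, one_pow]

/-- The factor `r²` of the metric is absorbed into the rescaled components, so scalar products of
conical fields do not depend on `r`. -/
theorem dot_spaceMetric (h : IsSphereChart Φ U) (hx : x ∈ cone U) (u w : Fin 3 → ℝ) :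
    dot (spaceMetric Φ) x u w =
      dot (sphereMetric Φ) (surfaceProj x) (fun α => x 2 * u α.castSucc)
        (fun α => x 2 * w α.castSucc) + u 2 * w 2 := by
  simp only [dot, sum_space, h.spaceMetric_castSucc hx, h.spaceMetric_castSucc_two hx,
    h.spaceMetric_two_castSucc hx, h.spaceMetric_two_two hx, Fin.sum_univ_two, zpow_ofNat]
  ring

theorem det_spaceMetric (h : IsSphereChart Φ U) (hx : x ∈ cone U) :
    (spaceMetric Φ x).det = x 2 ^ 4 * (sphereMetric Φ (surfaceProj x)).det := by
  have h00 := h.spaceMetric_castSucc hx 0 0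
  have h01 := h.spaceMetric_castSucc hx 0 1
  have h10 := h.spaceMetric_castSucc hx 1 0
  have h11 := h.spaceMetric_castSucc hx 1 1
  have h02 := h.spaceMetric_castSucc_two hx 0
  have h12 := h.spaceMetric_castSucc_two hx 1
  have h20 := h.spaceMetric_two_castSucc hx 0
  have h21 := h.spaceMetric_two_castSucc hx 1
  simp only [Fin.castSucc_zero, Fin.castSucc_one, zpow_ofNat] at h00 h01 h10 h11 h02 h12 h20 h21
  rw [Matrix.det_fin_three, Matrix.det_fin_two, h00, h01, h10, h11, h02, h12, h20, h21,
    h.spaceMetric_two_two hx]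
  ring

theorem sqrtDet_spaceMetric (h : IsSphereChart Φ U) (hx : x ∈ cone U) :
    sqrtDet (spaceMetric Φ) x = x 2 ^ (2 : ℤ) * sqrtDet (sphereMetric Φ) (surfaceProj x) := by
  have h4 : x 2 ^ 4 = (x 2 ^ 2) ^ 2 := by ring
  rw [sqrtDet, sqrtDet, h.det_spaceMetric hx, h4, Real.sqrt_mul (sq_nonneg _),
    Real.sqrt_sq (sq_nonneg _), zpow_ofNat]

theorem sum_metric_mul_inv (h : IsSphereChart Φ U) {ξ : Fin 2 → ℝ} (hξ : ξ ∈ U) (α β : Fin 2) :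
    ∑ γ, sphereMetric Φ ξ α γ * (sphereMetric Φ ξ)⁻¹ γ β = if α = β then 1 else 0 := by
  rw [← Matrix.mul_apply, h.metric_mul_inv hξ, Matrix.one_apply]

theorem sum_metric_inv_mul (h : IsSphereChart Φ U) {ξ : Fin 2 → ℝ} (hξ : ξ ∈ U) (α β : Fin 2) :
    ∑ γ, (sphereMetric Φ ξ)⁻¹ α γ * sphereMetric Φ ξ γ β = if α = β then 1 else 0 := by
  rw [← Matrix.mul_apply, h.metric_inv_mul hξ, Matrix.one_apply]

theorem spaceMetric_inv (h : IsSphereChart Φ U) (hx : x ∈ cone U) :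
    (spaceMetric Φ x)⁻¹ = coneInverse (sphereMetric Φ (surfaceProj x))⁻¹ (x 2) := by
  have hr := (mem_cone.1 hx).2.ne'
  refine Matrix.inv_eq_right_inv (Matrix.ext ?_)
  simp only [forall_space, Matrix.mul_apply, sum_space, h.spaceMetric_castSucc hx,
    h.spaceMetric_castSucc_two hx, h.spaceMetric_two_castSucc hx, h.spaceMetric_two_two hx,
    coneInverse_castSucc, coneInverse_castSucc_two, coneInverse_two_castSucc,
    coneInverse_two_two, Matrix.one_apply]
  refine ⟨fun α => ⟨fun β => ?_, ?_⟩, fun β => ?_, ?_⟩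
  · have := h.sum_metric_mul_inv (mem_cone.1 hx).1 α β
    simp only [Fin.castSucc_inj, zpow_ofNat, ← this, mul_zero, add_zero]
    refine Finset.sum_congr rfl fun γ _ => ?_
    field_simp
  · fin_cases α <;> simp
  · fin_cases β <;> simp
  · simp

theorem spaceMetric_inv_castSucc (h : IsSphereChart Φ U) (hx : x ∈ cone U) (α β : Fin 2) :
    (spaceMetric Φ x)⁻¹ α.castSucc β.castSucc =
      (sphereMetric Φ (surfaceProj x))⁻¹ α β / x 2 ^ 2 := by
  rw [h.spaceMetric_inv hx, coneInverse_castSucc]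

theorem spaceMetric_inv_castSucc_two (h : IsSphereChart Φ U) (hx : x ∈ cone U) (α : Fin 2) :
    (spaceMetric Φ x)⁻¹ α.castSucc 2 = 0 := by
  rw [h.spaceMetric_inv hx, coneInverse_castSucc_two]

theorem spaceMetric_inv_two_castSucc (h : IsSphereChart Φ U) (hx : x ∈ cone U) (α : Fin 2) :
    (spaceMetric Φ x)⁻¹ 2 α.castSucc = 0 := by
  rw [h.spaceMetric_inv hx, coneInverse_two_castSucc]

theorem spaceMetric_inv_two_two (h : IsSphereChart Φ U) (hx : x ∈ cone U) :
    (spaceMetric Φ x)⁻¹ 2 2 = 1 := by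
  rw [h.spaceMetric_inv hx, coneInverse_two_two]

/-! ### The Christoffel symbols of the cone -/

variable {ξ : Fin 2 → ℝ} {r : ℝ}

theorem differentiableAt_metric (h : IsSphereChart Φ U) (hξ : ξ ∈ U) (α β : Fin 2) :
    DifferentiableAt ℝ (fun η => sphereMetric Φ η α β) ξ :=
  ((h.contDiffOn_metric α β).differentiableOn one_ne_zero).differentiableAt
    (h.isOpen.mem_nhds hξ)

theorem pd_spaceMetric_castSucc (h : IsSphereChart Φ U) (hξ : ξ ∈ U) (hr : 0 < r)
    (α β γ : Fin 2) :
    pd γ.castSucc (fun y => spaceMetric Φ y α.castSucc β.castSucc) (pt ξ r) =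
      r ^ 2 * pd γ (fun η => sphereMetric Φ η α β) ξ := by
  rw [pd_castSucc_of_homogeneous h.isOpen (fun x hx => h.spaceMetric_castSucc hx α β) hξ
    (h.differentiableAt_metric hξ α β) hr, zpow_ofNat]

theorem pd_two_spaceMetric_castSucc (h : IsSphereChart Φ U) (hξ : ξ ∈ U) (hr : 0 < r)
    (α β : Fin 2) :
    pd 2 (fun y => spaceMetric Φ y α.castSucc β.castSucc) (pt ξ r) =
      2 * r * sphereMetric Φ ξ α β := by
  rw [pd_two_of_homogeneous h.isOpen (fun x hx => h.spaceMetric_castSucc hx α β) hξ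
    (h.differentiableAt_metric hξ α β) hr]
  norm_num

theorem pd_spaceMetric_castSucc_two (h : IsSphereChart Φ U) (hξ : ξ ∈ U) (hr : 0 < r)
    (α : Fin 2) (k : Fin 3) :
    pd k (fun y => spaceMetric Φ y α.castSucc 2) (pt ξ r) = 0 := by
  rw [pd_congr_of_eqOn (isOpen_cone h.isOpen)
    (fun x hx => h.spaceMetric_castSucc_two hx α) (pt_mem_cone hξ hr), pd_zero]

theorem pd_spaceMetric_two_castSucc (h : IsSphereChart Φ U) (hξ : ξ ∈ U) (hr : 0 < r)
    (α : Fin 2) (k : Fin 3) :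
    pd k (fun y => spaceMetric Φ y 2 α.castSucc) (pt ξ r) = 0 := by
  rw [pd_congr_of_eqOn (isOpen_cone h.isOpen)
    (fun x hx => h.spaceMetric_two_castSucc hx α) (pt_mem_cone hξ hr), pd_zero]

theorem pd_spaceMetric_two_two (h : IsSphereChart Φ U) (hξ : ξ ∈ U) (hr : 0 < r) (k : Fin 3) :
    pd k (fun y => spaceMetric Φ y 2 2) (pt ξ r) = 0 := by
  rw [pd_congr_of_eqOn (isOpen_cone h.isOpen)
    (fun x hx => h.spaceMetric_two_two hx) (pt_mem_cone hξ hr)]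
  simp [pd]

/-- The `r²` in the derivatives of the metric cancels the `r⁻²` of its inverse; the radial summand
dies with `G^{α3} = 0`. -/
theorem christoffel_castSucc (h : IsSphereChart Φ U) (hξ : ξ ∈ U) (hr : 0 < r) (α β γ : Fin 2) :
    christoffel (spaceMetric Φ) (pt ξ r) α.castSucc β.castSucc γ.castSucc =
      christoffel (sphereMetric Φ) ξ α β γ := by
  simp only [christoffel, sum_space, h.spaceMetric_inv_castSucc (pt_mem_cone hξ hr),
    h.spaceMetric_inv_castSucc_two (pt_mem_cone hξ hr), h.pd_spaceMetric_castSucc hξ hr,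
    surfaceProj_pt, pt_two]
  simp only [zero_div, zero_mul, add_zero]
  refine Finset.sum_congr rfl fun δ _ => ?_
  field_simp

/-- Half the radial derivative of `r² g` is `r g`; raising an index with `r⁻² g⁻¹` leaves `δ / r`.
-/
theorem christoffel_castSucc_castSucc_two (h : IsSphereChart Φ U) (hξ : ξ ∈ U) (hr : 0 < r)
    (α β : Fin 2) :
    christoffel (spaceMetric Φ) (pt ξ r) α.castSucc β.castSucc 2 =
      (if α = β then 1 else 0) / r := by
  simp only [christoffel, sum_space, h.spaceMetric_inv_castSucc (pt_mem_cone hξ hr),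
    h.spaceMetric_inv_castSucc_two (pt_mem_cone hξ hr), h.pd_two_spaceMetric_castSucc hξ hr,
    h.pd_spaceMetric_castSucc_two hξ hr, surfaceProj_pt, pt_two]
  simp only [← h.sum_metric_inv_mul hξ α β, zero_div, zero_mul, add_zero, sub_zero,
    Finset.sum_div]
  refine Finset.sum_congr rfl fun δ _ => ?_
  field_simp

theorem christoffel_castSucc_two_castSucc (h : IsSphereChart Φ U) (hξ : ξ ∈ U) (hr : 0 < r)
    (α β : Fin 2) :
    christoffel (spaceMetric Φ) (pt ξ r) α.castSucc 2 β.castSucc =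
      (if α = β then 1 else 0) / r := by
  rw [christoffel_symm (spaceMetric_symm Φ), h.christoffel_castSucc_castSucc_two hξ hr]

theorem christoffel_castSucc_two_two (h : IsSphereChart Φ U) (hξ : ξ ∈ U) (hr : 0 < r)
    (α : Fin 2) : christoffel (spaceMetric Φ) (pt ξ r) α.castSucc 2 2 = 0 := by
  simp only [christoffel, sum_space, h.spaceMetric_inv_castSucc_two (pt_mem_cone hξ hr),
    h.pd_spaceMetric_castSucc_two hξ hr, h.pd_spaceMetric_two_two hξ hr]
  simp

/-- Only `-∂_r (r² g_{αβ}) / 2` survives, since `G^{3α} = 0` and `G_{3α} = 0`. -/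
theorem christoffel_two_castSucc_castSucc (h : IsSphereChart Φ U) (hξ : ξ ∈ U) (hr : 0 < r)
    (α β : Fin 2) :
    christoffel (spaceMetric Φ) (pt ξ r) 2 α.castSucc β.castSucc = -r * sphereMetric Φ ξ α β := by
  simp only [christoffel, sum_space, h.spaceMetric_inv_two_castSucc (pt_mem_cone hξ hr),
    h.spaceMetric_inv_two_two (pt_mem_cone hξ hr), h.pd_two_spaceMetric_castSucc hξ hr,
    h.pd_spaceMetric_two_castSucc hξ hr]
  simp only [zero_div, zero_mul, Finset.sum_const_zero]
  ring

theorem christoffel_two_castSucc_two (h : IsSphereChart Φ U) (hξ : ξ ∈ U) (hr : 0 < r)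
    (α : Fin 2) : christoffel (spaceMetric Φ) (pt ξ r) 2 α.castSucc 2 = 0 := by
  simp only [christoffel, sum_space, h.spaceMetric_inv_two_castSucc (pt_mem_cone hξ hr),
    h.pd_spaceMetric_castSucc_two hξ hr, h.pd_spaceMetric_two_castSucc hξ hr,
    h.pd_spaceMetric_two_two hξ hr]
  simp

theorem christoffel_two_two (h : IsSphereChart Φ U) (hξ : ξ ∈ U) (hr : 0 < r)
    (k : Fin 3) : christoffel (spaceMetric Φ) (pt ξ r) 2 2 k = 0 := by
  revert k
  rw [forall_space]
  refine ⟨fun α => ?_, ?_⟩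
  · rw [christoffel_symm (spaceMetric_symm Φ), h.christoffel_two_castSucc_two hξ hr]
  · simp only [christoffel, sum_space, h.spaceMetric_inv_two_castSucc (pt_mem_cone hξ hr),
      h.pd_spaceMetric_two_two hξ hr]
    simp

end IsSphereChart

/-! ### Divergences of homogeneous relative tensors on the cone -/

/-- The divergence of a relative vector of weight `1` is the sum of the partial derivatives. -/
theorem divVec_one {n : ℕ} {g : MetricField n} (hg : ∀ x i j, g x i j = g x j i)
    (W : (Fin n → ℝ) → Fin n → ℝ) (x : Fin n → ℝ) :
    divVec g 1 W x = ∑ j, pd j (fun y => W y j) x := by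
  -- By symmetry of the symbols, the connection term of the divergence equals the weight-one
  -- correction, so the two cancel.
  have h1 : ∑ j, ∑ h, christoffel g x j h j * W x h =
      ∑ j, (∑ l, christoffel g x l l j) * W x j := by
    rw [Finset.sum_comm]
    refine Finset.sum_congr rfl fun j _ => ?_
    rw [Finset.sum_mul]
    exact Finset.sum_congr rfl fun l _ => by rw [christoffel_symm hg x l j l]
  simp only [divVec, covDerivVec, one_mul, Finset.sum_sub_distrib, Finset.sum_add_distrib, h1]
  ring

/-- Without the weight correction the contracted symbols remain; on the sphere they become the `∂√g
/ √g` terms of the radial magnetic equation. -/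
theorem divVec_zero {n : ℕ} {g : MetricField n} (hg : ∀ x i j, g x i j = g x j i)
    (W : (Fin n → ℝ) → Fin n → ℝ) (x : Fin n → ℝ) :
    divVec g 0 W x =
      ∑ j, pd j (fun y => W y j) x + ∑ j, (∑ l, christoffel g x l l j) * W x j := by
  rw [← divVec_one hg]
  simp only [divVec, covDerivVec, Finset.sum_sub_distrib]
  simp

namespace IsSphereChart

variable {Φ : (Fin 2 → ℝ) → EuclideanSpace ℝ (Fin 3)} {U : Set (Fin 2 → ℝ)}
  {ξ : Fin 2 → ℝ} {r : ℝ}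

theorem sum_christoffel_castSucc (h : IsSphereChart Φ U) (hξ : ξ ∈ U) (hr : 0 < r) (α : Fin 2) :
    ∑ l, christoffel (spaceMetric Φ) (pt ξ r) l l α.castSucc =
      ∑ l, christoffel (sphereMetric Φ) ξ l l α := by
  rw [sum_space, h.christoffel_two_two hξ hr, add_zero]
  exact Finset.sum_congr rfl fun β _ => h.christoffel_castSucc hξ hr β β α

theorem sum_christoffel_two (h : IsSphereChart Φ U) (hξ : ξ ∈ U) (hr : 0 < r) :
    ∑ l, christoffel (spaceMetric Φ) (pt ξ r) l l 2 = 2 / r := by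
  simp only [sum_space, h.christoffel_two_two hξ hr, h.christoffel_castSucc_castSucc_two hξ hr,
    Fin.sum_univ_two, if_true]
  ring

/-- In the coefficient of `X3`, `k + 1` comes from `∂_r r^{k+1}`, and `2 (1 - w)` from `Γ^l_{l3} =
2/r`, once in the connection term and `w` times in the correction. -/
theorem divVec_of_homogeneous (h : IsSphereChart Φ U) {w : ℝ} {k m : ℤ} (hm : m = k + 1)
    {W : (Fin 3 → ℝ) → Fin 3 → ℝ} {X : (Fin 2 → ℝ) → Fin 2 → ℝ} {X3 : (Fin 2 → ℝ) → ℝ}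
    (hW : ∀ α : Fin 2, ∀ x ∈ cone U, W x α.castSucc = x 2 ^ k * X (surfaceProj x) α)
    (hW3 : ∀ x ∈ cone U, W x 2 = x 2 ^ m * X3 (surfaceProj x))
    (hξ : ξ ∈ U) (hX : ∀ α, DifferentiableAt ℝ (fun η => X η α) ξ)
    (hX3 : DifferentiableAt ℝ X3 ξ) (hr : 0 < r) :
    divVec (spaceMetric Φ) w W (pt ξ r) =
      r ^ k * (divVec (sphereMetric Φ) w X ξ + (k + 1 + 2 * (1 - w)) * X3 ξ) := by
  have hx := pt_mem_cone hξ hr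
  have e1 : r ^ m = r * r ^ k := by rw [hm, zpow_add_one₀ hr.ne', mul_comm]
  have e2 : m - 1 = k := by omega
  have cm : (m : ℝ) = k + 1 := by rw [hm]; push_cast; ring
  have e3 : ∀ α, W (pt ξ r) (Fin.castSucc α) = r ^ k * X ξ α := fun α => by simp [hW α _ hx]
  have e4 : W (pt ξ r) 2 = r ^ m * X3 ξ := by simp [hW3 _ hx]
  simp only [divVec, covDerivVec]
  -- Only the outer sum is split here, so that the contracted symbols `∑ l, Γ^l_{lj}` stay intact
  -- for the next simplification.
  rw [sum_space]
  simp only [h.sum_christoffel_castSucc hξ hr,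
    h.sum_christoffel_two hξ hr]
  simp only [sum_space, h.christoffel_castSucc hξ hr,
    h.christoffel_castSucc_two_castSucc hξ hr, h.christoffel_two_castSucc_two hξ hr,
    h.christoffel_two_two hξ hr,
    pd_two_of_homogeneous h.isOpen hW3 hξ hX3 hr, e2, e3, e4]
  simp only [fun α => pd_castSucc_of_homogeneous h.isOpen (hW α) hξ (hX α) hr α,
    Fin.sum_univ_two, if_true, e1, cm]
  field_simp
  ring

variable {w : ℝ} {k m n : ℤ} {W : (Fin 3 → ℝ) → Fin 3 → Fin 3 → ℝ}
  {X : (Fin 2 → ℝ) → Fin 2 → Fin 2 → ℝ} {Y Z : (Fin 2 → ℝ) → Fin 2 → ℝ} {X3 : (Fin 2 → ℝ) → ℝ}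

/-- Compared with the vector case, the free surface index adds `Γ^α_{β3} Y^β = Y^α / r` (hence `k +
2`) and `Γ^α_{3β} Z^β = Z^α / r`. `Y` and `Z` are kept apart because the tensor need not be
symmetric. -/
theorem divTensor_castSucc_of_homogeneous (h : IsSphereChart Φ U) (hm : m = k + 1)
    (hW : ∀ α β : Fin 2, ∀ x ∈ cone U,
      W x α.castSucc β.castSucc = x 2 ^ k * X (surfaceProj x) α β)
    (hY : ∀ α : Fin 2, ∀ x ∈ cone U, W x α.castSucc 2 = x 2 ^ m * Y (surfaceProj x) α)
    (hZ : ∀ α : Fin 2, ∀ x ∈ cone U, W x 2 α.castSucc = x 2 ^ m * Z (surfaceProj x) α)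
    (hξ : ξ ∈ U) (hX' : ∀ α β, DifferentiableAt ℝ (fun η => X η α β) ξ)
    (hY' : ∀ α, DifferentiableAt ℝ (fun η => Y η α) ξ) (hr : 0 < r) (α : Fin 2) :
    divTensor (spaceMetric Φ) w W (pt ξ r) α.castSucc =
      r ^ k * (divTensor (sphereMetric Φ) w X ξ α + (k + 2 + 2 * (1 - w)) * Y ξ α + Z ξ α) := by
  have hx := pt_mem_cone hξ hr
  have e1 : r ^ m = r * r ^ k := by rw [hm, zpow_add_one₀ hr.ne', mul_comm]
  have e2 : m - 1 = k := by omega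
  have cm : (m : ℝ) = k + 1 := by rw [hm]; push_cast; ring
  have e3 : ∀ α β : Fin 2, W (pt ξ r) α.castSucc β.castSucc = r ^ k * X ξ α β :=
    fun α β => by simp [hW α β _ hx]
  have e4 : ∀ α : Fin 2, W (pt ξ r) α.castSucc 2 = r ^ m * Y ξ α := fun α => by simp [hY α _ hx]
  have e5 : ∀ α : Fin 2, W (pt ξ r) 2 α.castSucc = r ^ m * Z ξ α := fun α => by simp [hZ α _ hx]
  simp only [divTensor, covDerivTensor]
  rw [sum_space]
  simp only [h.sum_christoffel_castSucc hξ hr,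
    h.sum_christoffel_two hξ hr]
  simp only [sum_space, h.christoffel_castSucc hξ hr,
    h.christoffel_castSucc_two_castSucc hξ hr, h.christoffel_castSucc_castSucc_two hξ hr,
    h.christoffel_castSucc_two_two hξ hr, h.christoffel_two_castSucc_two hξ hr,
    h.christoffel_two_two hξ hr,
    fun α => pd_two_of_homogeneous h.isOpen (hY α) hξ (hY' α) hr, e2, e3, e4, e5]
  simp only [fun α β γ => pd_castSucc_of_homogeneous h.isOpen (hW α β) hξ (hX' α β) hr γ,
    e1, cm]
  fin_cases α <;> simp [Fin.sum_univ_two] <;> field_simp <;> ring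

/-- The free radial index contributes the trace, through `Γ^3_{αβ} = -r g_{αβ}`; here `k + 2` is the
exponent of the `33` component, differentiated in `r`. -/
theorem divTensor_two_of_homogeneous (h : IsSphereChart Φ U) (hm : m = k + 1) (hn : n = k + 2)
    (hW : ∀ α β : Fin 2, ∀ x ∈ cone U,
      W x α.castSucc β.castSucc = x 2 ^ k * X (surfaceProj x) α β)
    (hZ : ∀ α : Fin 2, ∀ x ∈ cone U, W x 2 α.castSucc = x 2 ^ m * Z (surfaceProj x) α)
    (hW3 : ∀ x ∈ cone U, W x 2 2 = x 2 ^ n * X3 (surfaceProj x))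
    (hξ : ξ ∈ U) (hZ' : ∀ α, DifferentiableAt ℝ (fun η => Z η α) ξ)
    (hX3 : DifferentiableAt ℝ X3 ξ) (hr : 0 < r) :
    divTensor (spaceMetric Φ) w W (pt ξ r) 2 =
      r ^ m * (divVec (sphereMetric Φ) w Z ξ + (k + 2 + 2 * (1 - w)) * X3 ξ
        - ∑ α, ∑ β, sphereMetric Φ ξ α β * X ξ α β) := by
  have hx := pt_mem_cone hξ hr
  have e1 : r ^ m = r * r ^ k := by rw [hm, zpow_add_one₀ hr.ne', mul_comm]
  have e1' : r ^ n = r * r * r ^ k := by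
    rw [hn, zpow_add₀ hr.ne', zpow_ofNat]; ring
  have cn : (n : ℝ) = k + 2 := by rw [hn]; push_cast; ring
  have e1'' : r ^ (n - 1) = r * r ^ k := by rw [← e1]; congr 1; omega
  have e3 : ∀ α β : Fin 2, W (pt ξ r) α.castSucc β.castSucc = r ^ k * X ξ α β :=
    fun α β => by simp [hW α β _ hx]
  have e4 : W (pt ξ r) 2 2 = r ^ n * X3 ξ := by simp [hW3 _ hx]
  have e5 : ∀ α : Fin 2, W (pt ξ r) 2 α.castSucc = r ^ m * Z ξ α := fun α => by simp [hZ α _ hx]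
  simp only [divTensor, divVec, covDerivVec, covDerivTensor]
  rw [sum_space]
  simp only [h.sum_christoffel_castSucc hξ hr, h.sum_christoffel_two hξ hr]
  simp only [sum_space, h.christoffel_castSucc hξ hr,
    h.christoffel_castSucc_two_castSucc hξ hr, h.christoffel_two_castSucc_castSucc hξ hr,
    h.christoffel_two_castSucc_two hξ hr,
    h.christoffel_two_two hξ hr,
    pd_two_of_homogeneous h.isOpen hW3 hξ hX3 hr, e3, e4, e5]
  simp only [fun α => pd_castSucc_of_homogeneous h.isOpen (hZ α) hξ (hZ' α) hr α,
    Fin.sum_univ_two, if_true, sphereMetric_symm Φ ξ 1 0, e1, e1', e1'', cn]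
  field_simp
  ring

/-- The contracted Christoffel symbols of the sphere are the logarithmic derivatives of `√g`. -/
theorem sum_christoffel_eq (h : IsSphereChart Φ U) (hξ : ξ ∈ U) (β : Fin 2) :
    ∑ l, christoffel (sphereMetric Φ) ξ l l β =
      1 / sqrtDet (sphereMetric Φ) ξ * pd β (sqrtDet (sphereMetric Φ)) ξ := by
  have hd := h.det_metric_pos hξ
  have hs := h.sqrtDet_pos hξ
  have hsq : sqrtDet (sphereMetric Φ) ξ * sqrtDet (sphereMetric Φ) ξ =
      (sphereMetric Φ ξ).det := Real.mul_self_sqrt hd.le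
  have D := fun α γ => (h.differentiableAt_metric hξ α γ).hasFDerivAt
  have hdet := ((D 0 0).mul (D 1 1)).sub ((D 0 1).mul (D 1 0))
  have hfun : sqrtDet (sphereMetric Φ) = fun η => Real.sqrt (sphereMetric Φ η 0 0 *
      sphereMetric Φ η 1 1 - sphereMetric Φ η 0 1 * sphereMetric Φ η 1 0) := by
    funext η; rw [sqrtDet, Matrix.det_fin_two]
  have hpd : pd β (sqrtDet (sphereMetric Φ)) ξ = 1 / (2 * sqrtDet (sphereMetric Φ) ξ) *
      (sphereMetric Φ ξ 0 0 * pd β (fun η => sphereMetric Φ η 1 1) ξ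
        + sphereMetric Φ ξ 1 1 * pd β (fun η => sphereMetric Φ η 0 0) ξ
        - (sphereMetric Φ ξ 0 1 * pd β (fun η => sphereMetric Φ η 1 0) ξ
        + sphereMetric Φ ξ 1 0 * pd β (fun η => sphereMetric Φ η 0 1) ξ)) := by
    have hd' := hd.ne'
    rw [Matrix.det_fin_two] at hd'
    have := (hdet.sqrt hd').fderiv
    rw [pd, hfun]
    refine (congrArg (fun L : (Fin 2 → ℝ) →L[ℝ] ℝ => L (Pi.single β 1)) this).trans ?_
    simp [pd]
  have e10 : (fun η => sphereMetric Φ η 1 0) = fun η => sphereMetric Φ η 0 1 :=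
    funext fun η => sphereMetric_symm Φ η 1 0
  -- The two square roots combine into `2 det g`, leaving a rational identity in the metric and its
  -- first derivatives.
  rw [hpd, ← mul_assoc, one_div_mul_one_div, mul_left_comm, hsq]
  simp only [christoffel, Matrix.inv_def, Matrix.adjugate_fin_two, Ring.inverse_eq_inv',
    Matrix.smul_apply, smul_eq_mul, Fin.sum_univ_two, Matrix.of_apply, Matrix.cons_val_zero,
    Matrix.cons_val_one, Matrix.cons_val', Matrix.cons_val_fin_one, sphereMetric_symm Φ ξ 1 0]
  fin_cases β <;> simp [e10] <;> field_simp <;> ring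

end IsSphereChart

/-! ### Regularity of surface states -/

theorem differentiableAt_div_real {n : ℕ} {f : (Fin n → ℝ) → ℝ} {x : Fin n → ℝ}
    (hf : DifferentiableAt ℝ f x) (c : ℝ) : DifferentiableAt ℝ (fun y => f y / c) x := by
  simpa only [div_eq_mul_inv] using hf.mul_const c⁻¹

namespace SurfaceState.IsRegular

variable {s : SurfaceState} {U : Set (Fin 2 → ℝ)} {D : Set (ℝ × ℝ)} {P : ℝ × ℝ → ℝ}
  {Φ : (Fin 2 → ℝ) → EuclideanSpace ℝ (Fin 3)} {ξ : Fin 2 → ℝ}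

theorem differentiableAt_v (hs : s.IsRegular U D) (hU : IsOpen U) (hξ : ξ ∈ U) (α : Fin 2) :
    DifferentiableAt ℝ (fun η => s.v η α) ξ :=
  differentiableAt_pi.1 ((hs.v.differentiableOn one_ne_zero).differentiableAt (hU.mem_nhds hξ)) α

theorem differentiableAt_b (hs : s.IsRegular U D) (hU : IsOpen U) (hξ : ξ ∈ U) (α : Fin 2) :
    DifferentiableAt ℝ (fun η => s.b η α) ξ :=
  differentiableAt_pi.1 ((hs.b.differentiableOn one_ne_zero).differentiableAt (hU.mem_nhds hξ)) α

theorem differentiableAt_ρ (hs : s.IsRegular U D) (hU : IsOpen U) (hξ : ξ ∈ U) :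
    DifferentiableAt ℝ s.ρ ξ :=
  (hs.ρ.differentiableOn one_ne_zero).differentiableAt (hU.mem_nhds hξ)

theorem differentiableAt_e (hs : s.IsRegular U D) (hU : IsOpen U) (hξ : ξ ∈ U) :
    DifferentiableAt ℝ s.e ξ :=
  (hs.e.differentiableOn one_ne_zero).differentiableAt (hU.mem_nhds hξ)

theorem differentiableAt_V3 (hs : s.IsRegular U D) (hU : IsOpen U) (hξ : ξ ∈ U) :
    DifferentiableAt ℝ s.V3 ξ :=
  (hs.V3.differentiableOn one_ne_zero).differentiableAt (hU.mem_nhds hξ)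

theorem differentiableAt_B3 (hs : s.IsRegular U D) (hU : IsOpen U) (hξ : ξ ∈ U) :
    DifferentiableAt ℝ s.B3 ξ :=
  (hs.B3.differentiableOn one_ne_zero).differentiableAt (hU.mem_nhds hξ)

theorem differentiableAt_pressure (hs : s.IsRegular U D) (hU : IsOpen U) (hD : IsOpen D)
    (hP : ContDiffOn ℝ 1 P D) (hξ : ξ ∈ U) : DifferentiableAt ℝ (s.pressure P) ξ := by
  have h1 : DifferentiableAt ℝ P (s.ρ ξ, s.e ξ) :=
    (hP.differentiableOn one_ne_zero).differentiableAt (hD.mem_nhds (hs.mem ξ hξ))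
  exact h1.comp ξ ((hs.differentiableAt_ρ hU hξ).prodMk (hs.differentiableAt_e hU hξ))

end SurfaceState.IsRegular

namespace IsSphereChart

variable {Φ : (Fin 2 → ℝ) → EuclideanSpace ℝ (Fin 3)} {U : Set (Fin 2 → ℝ)} {ξ : Fin 2 → ℝ}

theorem differentiableAt_sqrtDet (h : IsSphereChart Φ U) (hξ : ξ ∈ U) :
    DifferentiableAt ℝ (sqrtDet (sphereMetric Φ)) ξ :=
  (h.contDiffOn_sqrtDet.differentiableOn one_ne_zero).differentiableAt (h.isOpen.mem_nhds hξ)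

theorem differentiableAt_metric_inv (h : IsSphereChart Φ U) (hξ : ξ ∈ U) (α β : Fin 2) :
    DifferentiableAt ℝ (fun η => (sphereMetric Φ η)⁻¹ α β) ξ :=
  ((h.contDiffOn_metric_inv α β).differentiableOn one_ne_zero).differentiableAt
    (h.isOpen.mem_nhds hξ)

theorem differentiableAt_dot (h : IsSphereChart Φ U) (hξ : ξ ∈ U)
    {u w : (Fin 2 → ℝ) → Fin 2 → ℝ} (hu : ∀ α, DifferentiableAt ℝ (fun η => u η α) ξ)
    (hw : ∀ α, DifferentiableAt ℝ (fun η => w η α) ξ) :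
    DifferentiableAt ℝ (fun η => dot (sphereMetric Φ) η (u η) (w η)) ξ := by
  simp only [dot]
  exact DifferentiableAt.fun_sum fun α _ => DifferentiableAt.fun_sum fun β _ =>
    ((h.differentiableAt_metric hξ α β).mul (hu α)).mul (hw β)

variable {s : SurfaceState} {D : Set (ℝ × ℝ)}

theorem differentiableAt_normSqV (h : IsSphereChart Φ U) (hs : s.IsRegular U D) (hξ : ξ ∈ U) :
    DifferentiableAt ℝ (s.normSqV (sphereMetric Φ)) ξ :=
  (h.differentiableAt_dot hξ (hs.differentiableAt_v h.isOpen hξ)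
    (hs.differentiableAt_v h.isOpen hξ)).add ((hs.differentiableAt_V3 h.isOpen hξ).pow 2)

theorem differentiableAt_normSqB (h : IsSphereChart Φ U) (hs : s.IsRegular U D) (hξ : ξ ∈ U) :
    DifferentiableAt ℝ (s.normSqB (sphereMetric Φ)) ξ :=
  (h.differentiableAt_dot hξ (hs.differentiableAt_b h.isOpen hξ)
    (hs.differentiableAt_b h.isOpen hξ)).add ((hs.differentiableAt_B3 h.isOpen hξ).pow 2)

theorem differentiableAt_dotVB (h : IsSphereChart Φ U) (hs : s.IsRegular U D) (hξ : ξ ∈ U) :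
    DifferentiableAt ℝ (s.dotVB (sphereMetric Φ)) ξ :=
  (h.differentiableAt_dot hξ (hs.differentiableAt_v h.isOpen hξ)
    (hs.differentiableAt_b h.isOpen hξ)).add
    ((hs.differentiableAt_V3 h.isOpen hξ).mul (hs.differentiableAt_B3 h.isOpen hξ))

theorem differentiableAt_energy (h : IsSphereChart Φ U) (hs : s.IsRegular U D) (hξ : ξ ∈ U) :
    DifferentiableAt ℝ (s.energy (sphereMetric Φ)) ξ :=
  (hs.differentiableAt_e h.isOpen hξ).add (differentiableAt_div_real (h.differentiableAt_normSqV hs hξ) 2)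

end IsSphereChart

/-! ### Space states in terms of their rescaled components -/

namespace RescalesTo

variable {S : SpaceState} {s : SurfaceState} {U : Set (Fin 2 → ℝ)} {x : Fin 3 → ℝ}

theorem ρ_eq (h : RescalesTo S s U) (hx : x ∈ cone U) : S.ρ x = s.ρ (surfaceProj x) := by
  rw [h.ρ _ (mem_cone.1 hx).1 _ (mem_cone.1 hx).2, pt_surfaceProj]

theorem e_eq (h : RescalesTo S s U) (hx : x ∈ cone U) : S.e x = s.e (surfaceProj x) := by
  rw [h.e _ (mem_cone.1 hx).1 _ (mem_cone.1 hx).2, pt_surfaceProj]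

theorem mul_V_castSucc (h : RescalesTo S s U) (hx : x ∈ cone U) (α : Fin 2) :
    x 2 * S.V x α.castSucc = s.v (surfaceProj x) α := by
  rw [h.v _ (mem_cone.1 hx).1 _ (mem_cone.1 hx).2, pt_surfaceProj]

theorem V_castSucc (h : RescalesTo S s U) (hx : x ∈ cone U) (α : Fin 2) :
    S.V x α.castSucc = s.v (surfaceProj x) α / x 2 := by
  rw [← h.mul_V_castSucc hx, mul_div_cancel_left₀ _ (mem_cone.1 hx).2.ne']

theorem V_two (h : RescalesTo S s U) (hx : x ∈ cone U) : S.V x 2 = s.V3 (surfaceProj x) := by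
  rw [h.V3 _ (mem_cone.1 hx).1 _ (mem_cone.1 hx).2, pt_surfaceProj]

theorem mul_B_castSucc (h : RescalesTo S s U) (hx : x ∈ cone U) (α : Fin 2) :
    x 2 * S.B x α.castSucc = s.b (surfaceProj x) α := by
  rw [h.b _ (mem_cone.1 hx).1 _ (mem_cone.1 hx).2, pt_surfaceProj]

theorem B_castSucc (h : RescalesTo S s U) (hx : x ∈ cone U) (α : Fin 2) :
    S.B x α.castSucc = s.b (surfaceProj x) α / x 2 := by
  rw [← h.mul_B_castSucc hx, mul_div_cancel_left₀ _ (mem_cone.1 hx).2.ne']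

theorem B_two (h : RescalesTo S s U) (hx : x ∈ cone U) : S.B x 2 = s.B3 (surfaceProj x) := by
  rw [h.B3 _ (mem_cone.1 hx).1 _ (mem_cone.1 hx).2, pt_surfaceProj]

/-- The unit radius is a smooth section of the cone, on which rescaled and original components
coincide. -/
theorem isRegular {D : Set (ℝ × ℝ)} (h : RescalesTo S s U) (hS : S.IsRegular U D) :
    s.IsRegular U D where
  ρ := (contDiffOn_comp_pt_one hS.ρ).congr fun ξ hξ => h.ρ ξ hξ 1 one_pos
  e := (contDiffOn_comp_pt_one hS.e).congr fun ξ hξ => h.e ξ hξ 1 one_pos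
  v := contDiffOn_pi.2 fun α =>
    (contDiffOn_comp_pt_one (contDiffOn_pi.1 hS.V α.castSucc)).congr fun ξ hξ => by
      rw [h.v ξ hξ 1 one_pos, one_mul]
  V3 := (contDiffOn_comp_pt_one (contDiffOn_pi.1 hS.V 2)).congr fun ξ hξ => h.V3 ξ hξ 1 one_pos
  b := contDiffOn_pi.2 fun α =>
    (contDiffOn_comp_pt_one (contDiffOn_pi.1 hS.B α.castSucc)).congr fun ξ hξ => by
      rw [h.b ξ hξ 1 one_pos, one_mul]
  B3 := (contDiffOn_comp_pt_one (contDiffOn_pi.1 hS.B 2)).congr fun ξ hξ => h.B3 ξ hξ 1 one_pos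
  mem := fun ξ hξ => by
    rw [h.ρ ξ hξ 1 one_pos, h.e ξ hξ 1 one_pos]
    exact hS.mem _ (pt_mem_cone hξ one_pos)

variable {Φ : (Fin 2 → ℝ) → EuclideanSpace ℝ (Fin 3)} {P : ℝ × ℝ → ℝ}

theorem pressure_eq (h : RescalesTo S s U) (hx : x ∈ cone U) :
    S.pressure P x = s.pressure P (surfaceProj x) := by
  rw [SpaceState.pressure, h.ρ_eq hx, h.e_eq hx, SurfaceState.pressure]

theorem dot_V_V (h : RescalesTo S s U) (hΦ : IsSphereChart Φ U) (hx : x ∈ cone U) :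
    dot (spaceMetric Φ) x (S.V x) (S.V x) =
      s.normSqV (sphereMetric Φ) (surfaceProj x) := by
  simp only [hΦ.dot_spaceMetric hx, h.mul_V_castSucc hx, h.V_two hx, SurfaceState.normSqV, sq]

theorem dot_B_B (h : RescalesTo S s U) (hΦ : IsSphereChart Φ U) (hx : x ∈ cone U) :
    dot (spaceMetric Φ) x (S.B x) (S.B x) =
      s.normSqB (sphereMetric Φ) (surfaceProj x) := by
  simp only [hΦ.dot_spaceMetric hx, h.mul_B_castSucc hx, h.B_two hx, SurfaceState.normSqB, sq]

theorem dot_V_B (h : RescalesTo S s U) (hΦ : IsSphereChart Φ U) (hx : x ∈ cone U) :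
    dot (spaceMetric Φ) x (S.V x) (S.B x) =
      s.dotVB (sphereMetric Φ) (surfaceProj x) := by
  simp only [hΦ.dot_spaceMetric hx, h.mul_V_castSucc hx, h.mul_B_castSucc hx, h.V_two hx,
    h.B_two hx, SurfaceState.dotVB]

theorem energy_eq (h : RescalesTo S s U) (hΦ : IsSphereChart Φ U) (hx : x ∈ cone U) :
    S.energy (spaceMetric Φ) x = s.energy (sphereMetric Φ) (surfaceProj x) := by
  rw [SpaceState.energy, h.dot_V_V hΦ hx, h.e_eq hx, SurfaceState.energy]

/-! ### Reduction of the equations -/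

variable {D : Set (ℝ × ℝ)} {ξ : Fin 2 → ℝ} {r μ : ℝ}

/-- Here `k = -1` and `w = 0`: the derivative term `k + 1` vanishes, and `2 B³` comes entirely from
`Γ^l_{l3}`. -/
theorem divB_eq (h : RescalesTo S s U) (hΦ : IsSphereChart Φ U) (hs : s.IsRegular U D)
    (hξ : ξ ∈ U) (hr : 0 < r) :
    S.divB (spaceMetric Φ) (pt ξ r) = s.source (sphereMetric Φ) ξ / r := by
  rw [SpaceState.divB, hΦ.divVec_of_homogeneous (k := -1) (m := 0) (X := s.b) (X3 := s.B3)
    (by norm_num) (fun α x hx => ?_) (fun x hx => ?_) hξ (hs.differentiableAt_b hΦ.isOpen hξ)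
    (hs.differentiableAt_B3 hΦ.isOpen hξ) hr, SurfaceState.source, zpow_neg_one]
  · push_cast; ring
  · rw [h.B_castSucc hx, zpow_neg_one]; ring
  · rw [h.B_two hx, zpow_zero, one_mul]

/-- With weight one only `k + 1 = 2` is left; it is the exponent of `√G V³`. -/
theorem massEq_iff (h : RescalesTo S s U) (hΦ : IsSphereChart Φ U) (hs : s.IsRegular U D)
    (hξ : ξ ∈ U) (hr : 0 < r) :
    S.MassEq (spaceMetric Φ) (pt ξ r) ↔ s.MassEq (sphereMetric Φ) ξ := by
  have hρ := hs.differentiableAt_ρ hΦ.isOpen hξ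
  have hg := hΦ.differentiableAt_sqrtDet hξ
  rw [SpaceState.MassEq, hΦ.divVec_of_homogeneous (k := 1) (m := 2)
    (X := fun η β => s.ρ η * sqrtDet (sphereMetric Φ) η * s.v η β)
    (X3 := fun η => s.ρ η * sqrtDet (sphereMetric Φ) η * s.V3 η)
    (by norm_num) (fun α x hx => ?_) (fun x hx => ?_) hξ
    (fun α => (hρ.mul hg).mul (hs.differentiableAt_v hΦ.isOpen hξ α))
    ((hρ.mul hg).mul (hs.differentiableAt_V3 hΦ.isOpen hξ)) hr,
    divVec_one (sphereMetric_symm Φ), SurfaceState.MassEq, mul_eq_zero,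
    or_iff_right (zpow_ne_zero _ hr.ne')]
  · refine Eq.congr_left ?_
    push_cast; ring
  · have := (mem_cone.1 hx).2.ne'
    rw [SpaceState.massFlux, h.ρ_eq hx, h.V_castSucc hx, hΦ.sqrtDet_spaceMetric hx,
      zpow_ofNat, zpow_one]
    field_simp
  · rw [SpaceState.massFlux, h.ρ_eq hx, h.V_two hx, hΦ.sqrtDet_spaceMetric hx]
    ring

theorem energyEq_iff (h : RescalesTo S s U) (hΦ : IsSphereChart Φ U) (hs : s.IsRegular U D)
    (hD : IsOpen D) (hP : ContDiffOn ℝ 1 P D) (hξ : ξ ∈ U) (hr : 0 < r) :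
    S.EnergyEq (spaceMetric Φ) μ P (pt ξ r) ↔ s.EnergyEq (sphereMetric Φ) μ P ξ := by
  have hρ := hs.differentiableAt_ρ hΦ.isOpen hξ
  have hg := hΦ.differentiableAt_sqrtDet hξ
  have hc := ((hρ.mul (hΦ.differentiableAt_energy hs hξ)).add
    (hs.differentiableAt_pressure hΦ.isOpen hD hP hξ)).add
    (differentiableAt_div_real (hΦ.differentiableAt_normSqB hs hξ) μ)
  have hd := (hΦ.differentiableAt_dotVB hs hξ).const_mul (1 / μ)
  have hx := pt_mem_cone hξ hr
  rw [SpaceState.EnergyEq, hΦ.divVec_of_homogeneous (k := 1) (m := 2)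
    (X := fun η β => sqrtDet (sphereMetric Φ) η *
      ((s.ρ η * s.energy (sphereMetric Φ) η + s.pressure P η
        + s.normSqB (sphereMetric Φ) η / μ) * s.v η β
        - 1 / μ * s.dotVB (sphereMetric Φ) η * s.b η β))
    (X3 := fun η => sqrtDet (sphereMetric Φ) η *
      ((s.ρ η * s.energy (sphereMetric Φ) η + s.pressure P η
        + s.normSqB (sphereMetric Φ) η / μ) * s.V3 η
        - 1 / μ * s.dotVB (sphereMetric Φ) η * s.B3 η))
    (by norm_num) (fun α x hx => ?_) (fun x hx => ?_) hξ
    (fun α => hg.mul ((hc.mul (hs.differentiableAt_v hΦ.isOpen hξ α)).sub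
      (hd.mul (hs.differentiableAt_b hΦ.isOpen hξ α))))
    (hg.mul ((hc.mul (hs.differentiableAt_V3 hΦ.isOpen hξ)).sub
      (hd.mul (hs.differentiableAt_B3 hΦ.isOpen hξ)))) hr,
    divVec_one (sphereMetric_symm Φ), SurfaceState.EnergyEq, h.divB_eq hΦ hs hξ hr,
    hΦ.sqrtDet_spaceMetric hx, h.dot_V_B hΦ hx, surfaceProj_pt, pt_two, zpow_one, zpow_ofNat,
    -- Multiplies the surface equation by `r`, the degree of the space equation. The shape `_ + _`
    -- selects the surface equation, since the other left side is a product.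
    ← mul_right_inj' hr.ne' (b := _ + _)]
  · refine Eq.congr ?_ ?_
    · push_cast; ring
    · field_simp
  · have := (mem_cone.1 hx).2.ne'
    rw [SpaceState.energyFlux, h.ρ_eq hx, h.V_castSucc hx, h.B_castSucc hx,
      hΦ.sqrtDet_spaceMetric hx, h.dot_V_B hΦ hx, h.dot_B_B hΦ hx, h.energy_eq hΦ hx,
      h.pressure_eq hx, zpow_ofNat, zpow_one]
    field_simp
  · rw [SpaceState.energyFlux, h.ρ_eq hx, h.V_two hx, h.B_two hx,
      hΦ.sqrtDet_spaceMetric hx, h.dot_V_B hΦ hx, h.dot_B_B hΦ hx, h.energy_eq hΦ hx,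
      h.pressure_eq hx]
    ring

/-! ### Momentum equations -/

theorem momentumFlux_castSucc (h : RescalesTo S s U) (hΦ : IsSphereChart Φ U)
    (hx : x ∈ cone U) (α β : Fin 2) :
    S.momentumFlux (spaceMetric Φ) μ P x α.castSucc β.castSucc =
      x 2 ^ (0 : ℤ) * s.momentumFlux (sphereMetric Φ) μ P (surfaceProj x) α β := by
  have := (mem_cone.1 hx).2.ne'
  rw [SpaceState.momentumFlux, h.ρ_eq hx, h.V_castSucc hx, h.V_castSucc hx, h.B_castSucc hx,
    h.B_castSucc hx, hΦ.sqrtDet_spaceMetric hx, h.dot_B_B hΦ hx, h.pressure_eq hx,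
    hΦ.spaceMetric_inv_castSucc hx, SurfaceState.momentumFlux, zpow_ofNat, zpow_zero, one_mul]
  field_simp

theorem momentumFlux_two_castSucc (h : RescalesTo S s U) (hΦ : IsSphereChart Φ U)
    (hx : x ∈ cone U) (α : Fin 2) :
    S.momentumFlux (spaceMetric Φ) μ P x 2 α.castSucc = x 2 ^ (1 : ℤ) *
      (s.ρ (surfaceProj x) * sqrtDet (sphereMetric Φ) (surfaceProj x) * s.V3 (surfaceProj x) *
        s.v (surfaceProj x) α - sqrtDet (sphereMetric Φ) (surfaceProj x) / μ *
        s.B3 (surfaceProj x) * s.b (surfaceProj x) α) := by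
  have := (mem_cone.1 hx).2.ne'
  rw [SpaceState.momentumFlux, h.ρ_eq hx, h.V_castSucc hx, h.B_castSucc hx, h.V_two hx,
    h.B_two hx, hΦ.sqrtDet_spaceMetric hx, hΦ.spaceMetric_inv_two_castSucc hx, zpow_ofNat,
    zpow_one]
  field_simp
  ring

theorem momentumFlux_castSucc_two (h : RescalesTo S s U) (hΦ : IsSphereChart Φ U)
    (hx : x ∈ cone U) (α : Fin 2) :
    S.momentumFlux (spaceMetric Φ) μ P x α.castSucc 2 = x 2 ^ (1 : ℤ) *
      (s.ρ (surfaceProj x) * sqrtDet (sphereMetric Φ) (surfaceProj x) * s.V3 (surfaceProj x) *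
        s.v (surfaceProj x) α - sqrtDet (sphereMetric Φ) (surfaceProj x) / μ *
        s.B3 (surfaceProj x) * s.b (surfaceProj x) α) := by
  rw [← h.momentumFlux_two_castSucc (P := P) hΦ hx, SpaceState.momentumFlux,
    SpaceState.momentumFlux, hΦ.spaceMetric_inv_castSucc_two hx,
    hΦ.spaceMetric_inv_two_castSucc hx]
  ring

theorem momentumFlux_two_two (h : RescalesTo S s U) (hΦ : IsSphereChart Φ U)
    (hx : x ∈ cone U) :
    S.momentumFlux (spaceMetric Φ) μ P x 2 2 = x 2 ^ (2 : ℤ) *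
      (sqrtDet (sphereMetric Φ) (surfaceProj x) * (s.ρ (surfaceProj x) * s.V3 (surfaceProj x) ^ 2
        - 1 / μ * s.B3 (surfaceProj x) ^ 2 + (s.pressure P (surfaceProj x)
        + s.normSqB (sphereMetric Φ) (surfaceProj x) / (2 * μ)))) := by
  rw [SpaceState.momentumFlux, h.ρ_eq hx, h.V_two hx, h.B_two hx, hΦ.sqrtDet_spaceMetric hx,
    hΦ.spaceMetric_inv_two_two hx, h.dot_B_B hΦ hx, h.pressure_eq hx]
  ring

/-- The total pressure appears with `g_{αβ} g^{αβ} = 2`, exactly what cancels the pressure part of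
the `33` component in the radial equation. -/
theorem sum_metric_mul_momentumFlux (hΦ : IsSphereChart Φ U) (hξ : ξ ∈ U) :
    ∑ α, ∑ β, sphereMetric Φ ξ α β * s.momentumFlux (sphereMetric Φ) μ P ξ α β =
      sqrtDet (sphereMetric Φ) ξ * (s.ρ ξ * dot (sphereMetric Φ) ξ (s.v ξ) (s.v ξ)
        - 1 / μ * dot (sphereMetric Φ) ξ (s.b ξ) (s.b ξ)
        + 2 * (s.pressure P ξ + s.normSqB (sphereMetric Φ) ξ / (2 * μ))) := by
  have h0 := hΦ.sum_metric_mul_inv hξ 0 0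
  have h1 := hΦ.sum_metric_mul_inv hξ 1 1
  simp only [Fin.sum_univ_two, if_true, sphereMetric_symm Φ ξ 1 0] at h0 h1
  have hs : (sphereMetric Φ ξ)⁻¹ 1 0 = (sphereMetric Φ ξ)⁻¹ 0 1 := by
    simp [Matrix.inv_def, Matrix.adjugate_fin_two, sphereMetric_symm Φ ξ 1 0]
  simp only [SurfaceState.momentumFlux, dot, Fin.sum_univ_two, sphereMetric_symm Φ ξ 1 0, hs]
    at h0 h1 ⊢
  linear_combination (sqrtDet (sphereMetric Φ) ξ *
    (s.pressure P ξ + s.normSqB (sphereMetric Φ) ξ / (2 * μ))) * (h0 + h1)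

/-- The momentum flux is symmetric, so `Y = Z`, and the factor `3` is `(k + 2) + 1` with `k = 0`, `w
= 1`. Both sides have degree `0` in `r`. -/
theorem momentumEq_castSucc_iff (h : RescalesTo S s U) (hΦ : IsSphereChart Φ U)
    (hs : s.IsRegular U D) (hD : IsOpen D) (hP : ContDiffOn ℝ 1 P D) (hξ : ξ ∈ U) (hr : 0 < r)
    (α : Fin 2) :
    S.MomentumEq (spaceMetric Φ) μ P (pt ξ r) α.castSucc ↔
      s.MomentumEq (sphereMetric Φ) μ P ξ α := by
  have hρ := hs.differentiableAt_ρ hΦ.isOpen hξ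
  have hg := hΦ.differentiableAt_sqrtDet hξ
  have hv := hs.differentiableAt_v hΦ.isOpen hξ
  have hb := hs.differentiableAt_b hΦ.isOpen hξ
  have hx := pt_mem_cone hξ hr
  rw [SpaceState.MomentumEq, hΦ.divTensor_castSucc_of_homogeneous (k := 0) (m := 1)
    (by norm_num) (fun α β x hx => h.momentumFlux_castSucc hΦ hx α β)
    (Y := fun η α => s.ρ η * sqrtDet (sphereMetric Φ) η * s.V3 η * s.v η α
      - sqrtDet (sphereMetric Φ) η / μ * s.B3 η * s.b η α)
    (Z := fun η α => s.ρ η * sqrtDet (sphereMetric Φ) η * s.V3 η * s.v η α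
      - sqrtDet (sphereMetric Φ) η / μ * s.B3 η * s.b η α)
    (fun α x hx => h.momentumFlux_castSucc_two hΦ hx α)
    (fun α x hx => h.momentumFlux_two_castSucc hΦ hx α) hξ
    (fun α β => hg.mul ((((hρ.mul (hv α)).mul (hv β)).sub (((hb α).const_mul (1 / μ)).mul
      (hb β))).add ((hΦ.differentiableAt_metric_inv hξ α β).mul
      ((hs.differentiableAt_pressure hΦ.isOpen hD hP hξ).add
      (differentiableAt_div_real (hΦ.differentiableAt_normSqB hs hξ) _)))))
    (fun α => (((hρ.mul hg).mul (hs.differentiableAt_V3 hΦ.isOpen hξ)).mul (hv α)).sub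
      (((differentiableAt_div_real hg μ).mul (hs.differentiableAt_B3 hΦ.isOpen hξ)).mul (hb α))) hr α,
    SurfaceState.MomentumEq, h.divB_eq hΦ hs hξ hr, hΦ.sqrtDet_spaceMetric hx, h.B_castSucc hx,
    surfaceProj_pt, pt_two, zpow_ofNat]
  refine Eq.congr ?_ ?_
  · push_cast; ring
  · field_simp

theorem momentumEq_two_iff (h : RescalesTo S s U) (hΦ : IsSphereChart Φ U)
    (hs : s.IsRegular U D) (hD : IsOpen D) (hP : ContDiffOn ℝ 1 P D) (hξ : ξ ∈ U) (hr : 0 < r) :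
    S.MomentumEq (spaceMetric Φ) μ P (pt ξ r) 2 ↔ s.Momentum3Eq (sphereMetric Φ) μ ξ := by
  have hρ := hs.differentiableAt_ρ hΦ.isOpen hξ
  have hg := hΦ.differentiableAt_sqrtDet hξ
  have hv := hs.differentiableAt_v hΦ.isOpen hξ
  have hb := hs.differentiableAt_b hΦ.isOpen hξ
  have hV3 := hs.differentiableAt_V3 hΦ.isOpen hξ
  have hB3 := hs.differentiableAt_B3 hΦ.isOpen hξ
  have hx := pt_mem_cone hξ hr
  -- `v_c` and `b_c` are defined as square roots; squaring recovers the scalar products only because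
  -- these are nonnegative.
  have hdot : ∀ u, 0 ≤ dot (sphereMetric Φ) ξ u u := fun u => by
    rw [dot_sphereMetric]; exact real_inner_self_nonneg
  rw [SpaceState.MomentumEq, hΦ.divTensor_two_of_homogeneous (k := 0) (m := 1) (n := 2)
    (by norm_num) (by norm_num) (fun α β x hx => h.momentumFlux_castSucc hΦ hx α β)
    (Z := fun η α => s.ρ η * sqrtDet (sphereMetric Φ) η * s.V3 η * s.v η α
      - sqrtDet (sphereMetric Φ) η / μ * s.B3 η * s.b η α)
    (X3 := fun η => sqrtDet (sphereMetric Φ) η * (s.ρ η * s.V3 η ^ 2 - 1 / μ * s.B3 η ^ 2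
      + (s.pressure P η + s.normSqB (sphereMetric Φ) η / (2 * μ))))
    (fun α x hx => h.momentumFlux_two_castSucc hΦ hx α)
    (fun x hx => h.momentumFlux_two_two hΦ hx) hξ
    (fun α => (((hρ.mul hg).mul hV3).mul (hv α)).sub (((differentiableAt_div_real hg μ).mul hB3).mul (hb α)))
    (hg.mul (((hρ.mul (hV3.pow 2)).sub ((hB3.pow 2).const_mul (1 / μ))).add
      ((hs.differentiableAt_pressure hΦ.isOpen hD hP hξ).add
      (differentiableAt_div_real (hΦ.differentiableAt_normSqB hs hξ) _)))) hr,
    divVec_one (sphereMetric_symm Φ), sum_metric_mul_momentumFlux hΦ hξ,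
    SurfaceState.Momentum3Eq, h.divB_eq hΦ hs hξ hr, hΦ.sqrtDet_spaceMetric hx, h.B_two hx,
    surfaceProj_pt, pt_two, zpow_one, zpow_ofNat, SurfaceState.vc, SurfaceState.bc,
    Real.sq_sqrt (hdot _), Real.sq_sqrt (hdot _), ← mul_right_inj' hr.ne' (b := _ + _)]
  refine Eq.congr ?_ ?_
  · push_cast; ring
  · field_simp

/-! ### Magnetic equations -/

theorem magneticFlux_castSucc (h : RescalesTo S s U) (hx : x ∈ cone U) (α β : Fin 2) :
    S.magneticFlux x α.castSucc β.castSucc =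
      x 2 ^ (-2 : ℤ) * s.magneticFlux (surfaceProj x) α β := by
  rw [SpaceState.magneticFlux, h.V_castSucc hx, h.V_castSucc hx, h.B_castSucc hx,
    h.B_castSucc hx, SurfaceState.magneticFlux, zpow_neg, zpow_ofNat]
  ring

theorem magneticFlux_two_castSucc (h : RescalesTo S s U) (hx : x ∈ cone U) (α : Fin 2) :
    S.magneticFlux x 2 α.castSucc = x 2 ^ (-1 : ℤ) * (s.v (surfaceProj x) α *
      s.B3 (surfaceProj x) - s.V3 (surfaceProj x) * s.b (surfaceProj x) α) := by
  rw [SpaceState.magneticFlux, h.V_castSucc hx, h.B_castSucc hx, h.V_two hx, h.B_two hx,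
    zpow_neg_one]
  ring

theorem magneticFlux_castSucc_two (h : RescalesTo S s U) (hx : x ∈ cone U) (α : Fin 2) :
    S.magneticFlux x α.castSucc 2 = x 2 ^ (-1 : ℤ) * (s.V3 (surfaceProj x) *
      s.b (surfaceProj x) α - s.v (surfaceProj x) α * s.B3 (surfaceProj x)) := by
  rw [SpaceState.magneticFlux, h.V_castSucc hx, h.B_castSucc hx, h.V_two hx, h.B_two hx,
    zpow_neg_one]
  ring

/-- With `k = -2` and `w = 0` the coefficient of `Y` is `2`; antisymmetry gives `Z = -Y`, so a
single `Y` remains. -/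
theorem magneticEq_castSucc_iff (h : RescalesTo S s U) (hΦ : IsSphereChart Φ U)
    (hs : s.IsRegular U D) (hξ : ξ ∈ U) (hr : 0 < r) (α : Fin 2) :
    S.MagneticEq (spaceMetric Φ) (pt ξ r) α.castSucc ↔ s.MagneticEq (sphereMetric Φ) ξ α := by
  have hv := hs.differentiableAt_v hΦ.isOpen hξ
  have hb := hs.differentiableAt_b hΦ.isOpen hξ
  have hx := pt_mem_cone hξ hr
  rw [SpaceState.MagneticEq, hΦ.divTensor_castSucc_of_homogeneous (k := -2) (m := -1)
    (by norm_num) (fun α β x hx => h.magneticFlux_castSucc hx α β)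
    (Y := fun η α => s.V3 η * s.b η α - s.v η α * s.B3 η)
    (Z := fun η α => s.v η α * s.B3 η - s.V3 η * s.b η α)
    (fun α x hx => h.magneticFlux_castSucc_two hx α)
    (fun α x hx => h.magneticFlux_two_castSucc hx α) hξ
    (fun α β => ((hv β).mul (hb α)).sub ((hv α).mul (hb β)))
    (fun α => ((hs.differentiableAt_V3 hΦ.isOpen hξ).mul (hb α)).sub
      ((hv α).mul (hs.differentiableAt_B3 hΦ.isOpen hξ))) hr α,
    SurfaceState.MagneticEq, h.divB_eq hΦ hs hξ hr, h.V_castSucc hx,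
    surfaceProj_pt, pt_two, ← mul_right_inj' (zpow_ne_zero (-2) hr.ne') (b := _ + _)]
  refine Eq.congr ?_ ?_
  · push_cast; ring
  · rw [zpow_neg, zpow_ofNat]; field_simp

/-- Antisymmetry removes both the `33` component and the metric trace; what is left is a weight-zero
divergence on the sphere. -/
theorem magneticEq_two_iff (h : RescalesTo S s U) (hΦ : IsSphereChart Φ U)
    (hs : s.IsRegular U D) (hξ : ξ ∈ U) (hr : 0 < r) :
    S.MagneticEq (spaceMetric Φ) (pt ξ r) 2 ↔ s.Magnetic3Eq (sphereMetric Φ) ξ := by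
  have hv := hs.differentiableAt_v hΦ.isOpen hξ
  have hb := hs.differentiableAt_b hΦ.isOpen hξ
  have hx := pt_mem_cone hξ hr
  have hanti : ∑ α, ∑ β, sphereMetric Φ ξ α β * s.magneticFlux ξ α β = 0 := by
    simp only [Fin.sum_univ_two, SurfaceState.magneticFlux, sphereMetric_symm Φ ξ 1 0]
    ring
  rw [SpaceState.MagneticEq, hΦ.divTensor_two_of_homogeneous (k := -2) (m := -1) (n := 0)
    (by norm_num) (by norm_num) (fun α β x hx => h.magneticFlux_castSucc hx α β)
    (Z := fun η α => s.v η α * s.B3 η - s.V3 η * s.b η α) (X3 := fun _ => 0)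
    (fun α x hx => h.magneticFlux_two_castSucc hx α)
    (fun x hx => by rw [SpaceState.magneticFlux]; ring) hξ
    (fun α => ((hv α).mul (hs.differentiableAt_B3 hΦ.isOpen hξ)).sub
      ((hs.differentiableAt_V3 hΦ.isOpen hξ).mul (hb α)))
    (differentiableAt_const _) hr,
    divVec_zero (sphereMetric_symm Φ), hanti, SurfaceState.Magnetic3Eq, h.divB_eq hΦ hs hξ hr,
    h.V_two hx, surfaceProj_pt, ← mul_right_inj' (inv_ne_zero hr.ne') (b := _ + _), zpow_neg_one]
  simp only [hΦ.sum_christoffel_eq hξ]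
  refine Eq.congr ?_ ?_
  · simp only [Fin.sum_univ_two]; ring
  · ring

end RescalesTo

/-! ### Conical states -/

section

variable {Φ : (Fin 2 → ℝ) → EuclideanSpace ℝ (Fin 3)} {U : Set (Fin 2 → ℝ)}

/-- The right side is `(1/r) ∂_r (r W^α)`, which is why `r W^α` is the natural surface component. -/
theorem IsSphereChart.covDerivVec_castSucc_two (h : IsSphereChart Φ U)
    (W : (Fin 3 → ℝ) → Fin 3 → ℝ) {x : Fin 3 → ℝ} (hx : x ∈ cone U) (α : Fin 2) :
    covDerivVec (spaceMetric Φ) 0 W x α.castSucc 2 =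
      pd 2 (fun y => W y α.castSucc) x + W x α.castSucc / x 2 := by
  obtain ⟨hξ, hr⟩ := mem_cone.1 hx
  have h1 := h.christoffel_castSucc_castSucc_two hξ hr
  have h2 := h.christoffel_castSucc_two_two hξ hr
  rw [pt_surfaceProj] at h1 h2
  simp only [covDerivVec, sum_space, h1, h2]
  fin_cases α <;> simp <;> ring

theorem IsSphereChart.covDerivVec_two_two (h : IsSphereChart Φ U)
    (W : (Fin 3 → ℝ) → Fin 3 → ℝ) {x : Fin 3 → ℝ} (hx : x ∈ cone U) :
    covDerivVec (spaceMetric Φ) 0 W x 2 2 = pd 2 (fun y => W y 2) x := by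
  obtain ⟨hξ, hr⟩ := mem_cone.1 hx
  have h1 := h.christoffel_two_castSucc_two hξ hr
  have h2 := h.christoffel_two_two hξ hr 2
  rw [pt_surfaceProj] at h1 h2
  simp only [covDerivVec, sum_space, h1, h2]
  simp

/-- Vector fields with vanishing radial covariant derivative: the rescaled surface components
do not depend on the radius. -/
theorem IsSphereChart.rescaled_eq (h : IsSphereChart Φ U) {W : (Fin 3 → ℝ) → Fin 3 → ℝ}
    (hW : ContDiffOn ℝ 1 W (cone U))
    (h0 : ∀ x ∈ cone U, ∀ i, covDerivVec (spaceMetric Φ) 0 W x i 2 = 0) {ξ : Fin 2 → ℝ}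
    (hξ : ξ ∈ U) {r : ℝ} (hr : 0 < r) (α : Fin 2) :
    W (pt ξ 1) α.castSucc = r * W (pt ξ r) α.castSucc := by
  have hWα := contDiffOn_pi.1 hW α.castSucc
  -- The radial derivative of `r W^α` is `r W^α_{|3}`, hence zero; the constant is read off at `r =
  -- 1`.
  have key := eq_of_pd_two_eq_zero h.isOpen (F := fun x => x 2 * W x α.castSucc)
    ((contDiff_apply ℝ ℝ (2 : Fin 3)).contDiffOn.mul hWα) (fun x hx => ?_) hξ hr
  · simpa using key
  · have hd := ((hWα.differentiableOn one_ne_zero).differentiableAt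
      ((isOpen_cone h.isOpen).mem_nhds hx)).hasFDerivAt
    have h1 : HasFDerivAt (fun y : Fin 3 → ℝ => y 2)
      (ContinuousLinearMap.proj (R := ℝ) (φ := fun _ : Fin 3 => ℝ) 2) x := hasFDerivAt_apply 2 x
    have h2 := h0 x hx α.castSucc
    have hr' := (mem_cone.1 hx).2.ne'
    rw [h.covDerivVec_castSucc_two W hx] at h2
    rw [pd] at h2
    field_simp at h2
    refine (congrArg (fun L : (Fin 3 → ℝ) →L[ℝ] ℝ => L (Pi.single 2 1)) (h1.mul hd).fderiv).trans ?_
    simpa [mul_comm] using h2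

theorem IsSphereChart.exists_rescalesTo (h : IsSphereChart Φ U) {S : SpaceState}
    {D : Set (ℝ × ℝ)} (hS : S.IsRegular U D) (hc : S.IsConical Φ U) :
    ∃ s : SurfaceState, RescalesTo S s U :=
  ⟨⟨fun ξ => S.ρ (pt ξ 1), fun ξ => S.e (pt ξ 1), fun ξ α => S.V (pt ξ 1) α.castSucc,
    fun ξ => S.V (pt ξ 1) 2, fun ξ α => S.B (pt ξ 1) α.castSucc, fun ξ => S.B (pt ξ 1) 2⟩,
  { ρ := fun _ hξ _ hr => eq_of_pd_two_eq_zero h.isOpen hS.ρ hc.ρ hξ hr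
    e := fun _ hξ _ hr => eq_of_pd_two_eq_zero h.isOpen hS.e hc.e hξ hr
    v := fun _ hξ _ hr α => h.rescaled_eq hS.V hc.V hξ hr α
    V3 := fun _ hξ _ hr => eq_of_pd_two_eq_zero h.isOpen (contDiffOn_pi.1 hS.V 2)
      (fun x hx => (h.covDerivVec_two_two S.V hx).symm.trans (hc.V x hx 2)) hξ hr
    b := fun _ hξ _ hr α => h.rescaled_eq hS.B hc.B hξ hr α
    B3 := fun _ hξ _ hr => eq_of_pd_two_eq_zero h.isOpen (contDiffOn_pi.1 hS.B 2)
      (fun x hx => (h.covDerivVec_two_two S.B hx).symm.trans (hc.B x hx 2)) hξ hr }⟩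

/-- The vector field on the cone with rescaled surface components `u` and radial component
`u3`. -/
def coneVec (u : (Fin 2 → ℝ) → Fin 2 → ℝ) (u3 : (Fin 2 → ℝ) → ℝ) (x : Fin 3 → ℝ) :
    Fin 3 → ℝ :=
  ![x 2 ^ (-1 : ℤ) * u (surfaceProj x) 0, x 2 ^ (-1 : ℤ) * u (surfaceProj x) 1,
    u3 (surfaceProj x)]

/-- Writing `1/r` as `r ^ (-1 : ℤ)` makes this the homogeneity hypothesis with `k = -1`. -/
theorem coneVec_castSucc (u : (Fin 2 → ℝ) → Fin 2 → ℝ) (u3 : (Fin 2 → ℝ) → ℝ) (x : Fin 3 → ℝ)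
    (α : Fin 2) : coneVec u u3 x α.castSucc = x 2 ^ (-1 : ℤ) * u (surfaceProj x) α := by
  fin_cases α <;> rfl

theorem coneVec_two (u : (Fin 2 → ℝ) → Fin 2 → ℝ) (u3 : (Fin 2 → ℝ) → ℝ) (x : Fin 3 → ℝ) :
    coneVec u u3 x 2 = u3 (surfaceProj x) := rfl

variable {u : (Fin 2 → ℝ) → Fin 2 → ℝ} {u3 : (Fin 2 → ℝ) → ℝ}

theorem contDiffOn_coneVec (hu : ContDiffOn ℝ 1 u U) (hu3 : ContDiffOn ℝ 1 u3 U) :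
    ContDiffOn ℝ 1 (coneVec u u3) (cone U) := by
  rw [contDiffOn_pi, forall_space]
  refine ⟨fun α => ?_, contDiffOn_comp_surfaceProj hu3⟩
  simp only [coneVec_castSucc, zpow_neg_one]
  exact ((contDiff_apply ℝ ℝ (2 : Fin 3)).contDiffOn.inv fun x hx => (mem_cone.1 hx).2.ne').mul
    (contDiffOn_comp_surfaceProj (contDiffOn_pi.1 hu α))

theorem pd_two_comp_surfaceProj (hU : IsOpen U) {f : (Fin 2 → ℝ) → ℝ} (hf : ContDiffOn ℝ 1 f U)
    {x : Fin 3 → ℝ} (hx : x ∈ cone U) : pd 2 (fun y => f (surfaceProj y)) x = 0 := by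
  obtain ⟨hξ, hr⟩ := mem_cone.1 hx
  rw [← pt_surfaceProj x, pd_two_of_homogeneous (k := 0) hU (fun y _ => by rw [zpow_zero, one_mul])
    hξ ((hf.differentiableOn one_ne_zero).differentiableAt (hU.mem_nhds hξ)) hr]
  simp

/-- For surface components `∂_r (u/r) = -u/r²` cancels the connection term `(u/r)/r`. -/
theorem IsSphereChart.covDerivVec_coneVec (h : IsSphereChart Φ U) (hu : ContDiffOn ℝ 1 u U)
    (hu3 : ContDiffOn ℝ 1 u3 U) {x : Fin 3 → ℝ} (hx : x ∈ cone U) (i : Fin 3) :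
    covDerivVec (spaceMetric Φ) 0 (coneVec u u3) x i 2 = 0 := by
  obtain ⟨hξ, hr⟩ := mem_cone.1 hx
  revert i
  rw [forall_space]
  refine ⟨fun α => ?_, ?_⟩
  · have := pd_two_of_homogeneous (k := -1) h.isOpen
      (fun y _ => coneVec_castSucc u u3 y α) hξ
      (((contDiffOn_pi.1 hu α).differentiableOn one_ne_zero).differentiableAt
        (h.isOpen.mem_nhds hξ)) hr
    rw [pt_surfaceProj] at this
    rw [h.covDerivVec_castSucc_two _ hx, this, coneVec_castSucc, zpow_sub_one₀ hr.ne']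
    push_cast
    ring
  · rw [h.covDerivVec_two_two _ hx]
    exact pd_two_comp_surfaceProj h.isOpen hu3 hx

theorem IsSphereChart.exists_conical (h : IsSphereChart Φ U) {s : SurfaceState}
    {D : Set (ℝ × ℝ)} (hs : s.IsRegular U D) :
    ∃ S : SpaceState, S.IsRegular U D ∧ S.IsConical Φ U ∧ RescalesTo S s U := by
  refine ⟨⟨fun x => s.ρ (surfaceProj x), fun x => s.e (surfaceProj x), coneVec s.v s.V3,
    coneVec s.b s.B3⟩, ?_, ?_, ?_⟩
  · exact
    { ρ := contDiffOn_comp_surfaceProj hs.ρ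
      e := contDiffOn_comp_surfaceProj hs.e
      V := contDiffOn_coneVec hs.v hs.V3
      B := contDiffOn_coneVec hs.b hs.B3
      mem := fun x hx => hs.mem _ (mem_cone.1 hx).1 }
  · exact
    { ρ := fun x hx => pd_two_comp_surfaceProj h.isOpen hs.ρ hx
      e := fun x hx => pd_two_comp_surfaceProj h.isOpen hs.e hx
      V := fun x hx => h.covDerivVec_coneVec hs.v hs.V3 hx
      B := fun x hx => h.covDerivVec_coneVec hs.b hs.B3 hx }
  · constructor <;> intro ξ hξ r hr
    · simp
    · simp
    · intro α
      change _ = r * coneVec s.v s.V3 (pt ξ r) α.castSucc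
      rw [coneVec_castSucc, surfaceProj_pt, pt_two, zpow_neg_one, mul_inv_cancel_left₀ hr.ne']
    · simp [coneVec_two]
    · intro α
      change _ = r * coneVec s.b s.B3 (pt ξ r) α.castSucc
      rw [coneVec_castSucc, surfaceProj_pt, pt_two, zpow_neg_one, mul_inv_cancel_left₀ hr.ne']
    · simp [coneVec_two]

end

end ConicalMHD
end
-- From the pointwise equivalences to the two systems
theorem mainTheorem1
    (Φ : (Fin 2 → ℝ) → EuclideanSpace ℝ (Fin 3)) (U : Set (Fin 2 → ℝ))
    (hΦ : ConicalMHD.IsSphereChart Φ U)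
    (μ : ℝ) (hμ : μ ≠ 0)
    (P : ℝ × ℝ → ℝ) (D : Set (ℝ × ℝ)) (hD : IsOpen D) (hP : ContDiffOn ℝ 1 P D) :
    -- the rescaled components of a conical state are functions on the sphere
    (∀ S : ConicalMHD.SpaceState, S.IsRegular U D → S.IsConical Φ U →
      ∃ s : ConicalMHD.SurfaceState, s.IsRegular U D ∧ ConicalMHD.RescalesTo S s U) ∧
    -- every state on the sphere is the rescaled form of a conical state
    (∀ s : ConicalMHD.SurfaceState, s.IsRegular U D →
      ∃ S : ConicalMHD.SpaceState, S.IsRegular U D ∧ S.IsConical Φ U ∧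
        ConicalMHD.RescalesTo S s U) ∧
    ∀ (S : ConicalMHD.SpaceState) (s : ConicalMHD.SurfaceState),
      S.IsRegular U D → S.IsConical Φ U → ConicalMHD.RescalesTo S s U →
      -- the divergence of the magnetic field
      (∀ ξ ∈ U, ∀ r : ℝ, 0 < r →
        S.divB (ConicalMHD.spaceMetric Φ) (ConicalMHD.pt ξ r) =
          (ConicalMHD.divVec (ConicalMHD.sphereMetric Φ) 0 s.b ξ + 2 * s.B3 ξ) / r) ∧
      -- equivalence, equation by equation
      (∀ ξ ∈ U, ∀ r : ℝ, 0 < r →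
        (S.MassEq (ConicalMHD.spaceMetric Φ) (ConicalMHD.pt ξ r) ↔
          s.MassEq (ConicalMHD.sphereMetric Φ) ξ) ∧
        (∀ α : Fin 2,
          S.MomentumEq (ConicalMHD.spaceMetric Φ) μ P (ConicalMHD.pt ξ r) α.castSucc ↔
            s.MomentumEq (ConicalMHD.sphereMetric Φ) μ P ξ α) ∧
        (S.MomentumEq (ConicalMHD.spaceMetric Φ) μ P (ConicalMHD.pt ξ r) 2 ↔
          s.Momentum3Eq (ConicalMHD.sphereMetric Φ) μ ξ) ∧
        (S.EnergyEq (ConicalMHD.spaceMetric Φ) μ P (ConicalMHD.pt ξ r) ↔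
          s.EnergyEq (ConicalMHD.sphereMetric Φ) μ P ξ) ∧
        (∀ α : Fin 2,
          S.MagneticEq (ConicalMHD.spaceMetric Φ) (ConicalMHD.pt ξ r) α.castSucc ↔
            s.MagneticEq (ConicalMHD.sphereMetric Φ) ξ α) ∧
        (S.MagneticEq (ConicalMHD.spaceMetric Φ) (ConicalMHD.pt ξ r) 2 ↔
          s.Magnetic3Eq (ConicalMHD.sphereMetric Φ) ξ)) ∧
      -- equivalence of the two systems
      ((∀ x ∈ ConicalMHD.cone U, S.SteadyMHDAt (ConicalMHD.spaceMetric Φ) μ P x) ↔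
        ∀ ξ ∈ U, s.ConicalMHDAt (ConicalMHD.sphereMetric Φ) μ P ξ) := by
  refine ⟨fun S hS hc => ?_, fun s hs => hΦ.exists_conical hs, fun S s hS _ h => ?_⟩
  · obtain ⟨s, h⟩ := hΦ.exists_rescalesTo hS hc
    exact ⟨s, h.isRegular hS, h⟩
  have hs := h.isRegular hS
  refine ⟨fun ξ hξ r hr => h.divB_eq hΦ hs hξ hr, fun ξ hξ r hr =>
    ⟨h.massEq_iff hΦ hs hξ hr, fun α => h.momentumEq_castSucc_iff hΦ hs hD hP hξ hr α,
      h.momentumEq_two_iff hΦ hs hD hP hξ hr, h.energyEq_iff hΦ hs hD hP hξ hr,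
      fun α => h.magneticEq_castSucc_iff hΦ hs hξ hr α, h.magneticEq_two_iff hΦ hs hξ hr⟩,
    fun H ξ hξ => ?_, fun H x hx => ?_⟩
  -- One point on each ray suffices, since the surface equations do not involve `r`.
  · obtain ⟨h1, h2, h3, h4⟩ := H _ (ConicalMHD.pt_mem_cone hξ one_pos)
    exact ⟨(h.massEq_iff hΦ hs hξ one_pos).1 h1,
      fun α => (h.momentumEq_castSucc_iff hΦ hs hD hP hξ one_pos α).1 (h2 _),
      (h.momentumEq_two_iff hΦ hs hD hP hξ one_pos).1 (h2 2),
      (h.energyEq_iff hΦ hs hD hP hξ one_pos).1 h3,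
      fun α => (h.magneticEq_castSucc_iff hΦ hs hξ one_pos α).1 (h4 _),
      (h.magneticEq_two_iff hΦ hs hξ one_pos).1 (h4 2)⟩
  · obtain ⟨hξ, hr⟩ := ConicalMHD.mem_cone.1 hx
    obtain ⟨h1, h2, h3, h4, h5, h6⟩ := H _ hξ
    rw [← ConicalMHD.pt_surfaceProj x]
    exact ⟨(h.massEq_iff hΦ hs hξ hr).2 h1,
      ConicalMHD.forall_space.2 ⟨fun α =>
        (h.momentumEq_castSucc_iff hΦ hs hD hP hξ hr α).2 (h2 α),
        (h.momentumEq_two_iff hΦ hs hD hP hξ hr).2 h3⟩,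
      (h.energyEq_iff hΦ hs hD hP hξ hr).2 h4,
      ConicalMHD.forall_space.2 ⟨fun α => (h.magneticEq_castSucc_iff hΦ hs hξ hr α).2 (h5 α),
        (h.magneticEq_two_iff hΦ hs hξ hr).2 h6⟩⟩
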